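/- Let $r_1,r_2,\lambda>0$ and let $\mathrm{PG}(r_1,r_2,\lambda)$ denote the law of the product $Y_1Y_2$ of independent random variables $Y_1\sim\Gamma(r_1,\lambda)$, $Y_2\sim\Gamma(r_2,\lambda)$, where $\Gamma(r,\lambda)$ has density $\frac{\lambda^r}{\Gamma(r)}x^{r-1}e^{-\lambda x}$ on $\mathbb{R}_+=(0,\infty)$. For $x>0$ let $$I_\nu(x)=\sum_{k=0}^\infty\frac{1}{\Gamma(\nu+k+1)\,k!}\Big(\frac x2\Big)^{\nu+2k},\qquad K_\nu(x)=\int_0^\infty e^{-x\cosh t}\cosh(\nu t)\,dt$$ be the modified Bessel functions. Let $h:\mathbb{R}_+\to\mathbb{R}$ be bounded and (Lebesgue) measurable, and put $\tilde h(x)=h(x)-\mathbb{E}h(Y)$ with $Y\sim\mathrm{PG}(r_1,r_2,\lambda)$. Consider on $\mathbb{R}_+$ the Stein equation $$x^2f''(x)+(1+r_1+r_2)xf'(x)+(r_1r_2-\lambda^2x)f(x)=\tilde h(x),\qquad (\ast)$$ where a solution is a differentiable function $f:\mathbb{R}_+\to\mathbb{R}$ whose derivative is locally absolutely continuous and which satisfies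 $(\ast)$ for almost every $x>0$. Then $\mathbb{E}|h(Y)|<\infty$, all integrals below converge absolutely, and $(\ast)$ has exactly one bounded solution, namely, for $x>0$, $$\begin{aligned}f(x)&=-\frac{2K_{r_1-r_2}(2\lambda\sqrt x)}{x^{(r_1+r_2)/2}}\int_0^x t^{(r_1+r_2)/2-1}I_{|r_1-r_2|}(2\lambda\sqrt t)\,\tilde h(t)\,dt+\frac{2I_{|r_1-r_2|}(2\lambda\sqrt x)}{x^{(r_1+r_2)/2}}\int_0^x t^{(r_1+r_2)/2-1}K_{r_1-r_2}(2\lambda\sqrt t)\,\tilde h(t)\,dt\\&=-\frac{2K_{r_1-r_2}(2\lambda\sqrt x)}{x^{(r_1+r_2)/2}}\int_0^x t^{(r_1+r_2)/2-1}I_{|r_1-r_2|}(2\lambda\sqrt t)\,\tilde h(t)\,dt-\frac{2I_{|r_1-r_2|}(2\lambda\sqrt x)}{x^{(r_1+r_2)/2}}\int_x^\infty t^{(r_1+r_2)/2-1}K_{r_1-r_2}(2\lambda\sqrt t)\,\tilde h(t)\,dt.\end{aligned}$$ Moreover, $f$ is twice differentiable and satisfies $(\ast)$ at each $x>0$ at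 which $h$ is continuous (so at every $x>0$ if $h$ is continuous), and every bounded twice differentiable function that satisfies $(\ast)$ at every $x>0$ equals $f$. -/

import Mathlib

open Real Set MeasureTheory ProbabilityTheory Filter Topology

noncomputable section

/-- Modified Bessel function of the first kind,
`I_ν(x) = ∑ₖ (x/2)^(ν+2k) / (Γ(ν+k+1) k!)`. At a pole of `Γ` the coefficient is `0`, as usual
(`Real.Gamma` vanishes there and `1 / 0 = 0`). It is only used at arguments `x > 0`. -/
def besselI (ν x : ℝ) : ℝ :=
  ∑' k : ℕ, 1 / (Real.Gamma (ν + k + 1) * (k.factorial : ℝ)) * (x / 2) ^ (ν + 2 * (k : ℝ))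

/-- Modified Bessel function of the second kind,
`K_ν(x) = ∫₀^∞ exp(-x cosh t) cosh(ν t) dt`, for `x > 0`. -/
def besselK (ν x : ℝ) : ℝ :=
  ∫ t in Ioi (0 : ℝ), Real.exp (-x * Real.cosh t) * Real.cosh (ν * t)

/-- The product gamma distribution `PG(r₁, r₂, lam)`: the law of `Y₁ * Y₂` for independent
`Y₁ ∼ Γ(r₁, lam)` and `Y₂ ∼ Γ(r₂, lam)` (`lam` is the rate). -/
def productGamma (r₁ r₂ lam : ℝ) : Measure ℝ :=
  ((gammaMeasure r₁ lam).prod (gammaMeasure r₂ lam)).map (fun p : ℝ × ℝ => p.1 * p.2)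

/-- The function `x ↦ h x - E h(Y)` with `Y ∼ PG(r₁, r₂, lam)`. -/
def centred (r₁ r₂ lam : ℝ) (h : ℝ → ℝ) (x : ℝ) : ℝ :=
  h x - ∫ y, h y ∂(productGamma r₁ r₂ lam)

/-- `f` is twice differentiable at the point `x` and satisfies the Stein equation
`x² f'' + (1 + r₁ + r₂) x f' + (r₁ r₂ - lam² x) f = h - E h(Y)` there. -/
def SteinEquationAt (r₁ r₂ lam : ℝ) (h f : ℝ → ℝ) (x : ℝ) : Prop :=
  DifferentiableAt ℝ f x ∧ DifferentiableAt ℝ (deriv f) x ∧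
    x ^ 2 * deriv (deriv f) x + (1 + r₁ + r₂) * x * deriv f x
      + (r₁ * r₂ - lam ^ 2 * x) * f x = centred r₁ r₂ lam h x

/-- Solutions of the Stein equation on `(0, ∞)` for a measurable right-hand side, in the usual
(Carathéodory) sense: `f` is differentiable, `f'` is locally absolutely continuous, and the
equation holds almost everywhere. -/
def IsSteinSolution (r₁ r₂ lam : ℝ) (h f : ℝ → ℝ) : Prop :=
  (∀ x, 0 < x → DifferentiableAt ℝ f x) ∧
  (∀ a b : ℝ, 0 < a → a ≤ b → AbsolutelyContinuousOnInterval (deriv f) a b) ∧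
  ∀ᵐ x ∂(volume.restrict (Ioi (0 : ℝ))), SteinEquationAt r₁ r₂ lam h f x

/-- `f` is bounded on `(0, ∞)`. -/
def BoundedOnPos (f : ℝ → ℝ) : Prop :=
  ∃ C : ℝ, ∀ x, 0 < x → |f x| ≤ C

/-- `t^((r₁+r₂)/2-1) I_{|r₁-r₂|}(2 lam √t) (h t - E h(Y))`. -/
def integrandI (r₁ r₂ lam : ℝ) (h : ℝ → ℝ) (t : ℝ) : ℝ :=
  t ^ ((r₁ + r₂) / 2 - 1) * besselI |r₁ - r₂| (2 * lam * √t) * centred r₁ r₂ lam h t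

/-- `t^((r₁+r₂)/2-1) K_{r₁-r₂}(2 lam √t) (h t - E h(Y))`. -/
def integrandK (r₁ r₂ lam : ℝ) (h : ℝ → ℝ) (t : ℝ) : ℝ :=
  t ^ ((r₁ + r₂) / 2 - 1) * besselK (r₁ - r₂) (2 * lam * √t) * centred r₁ r₂ lam h t

/-- The explicit solution, with both integrals over `(0, x)`. -/
def steinSolution (r₁ r₂ lam : ℝ) (h : ℝ → ℝ) (x : ℝ) : ℝ :=
  -(2 * besselK (r₁ - r₂) (2 * lam * √x) / x ^ ((r₁ + r₂) / 2))
      * (∫ t in Ioo 0 x, integrandI r₁ r₂ lam h t)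
    + 2 * besselI |r₁ - r₂| (2 * lam * √x) / x ^ ((r₁ + r₂) / 2)
      * (∫ t in Ioo 0 x, integrandK r₁ r₂ lam h t)

/-- The same solution, with the second integral over `(x, ∞)`. -/
def steinSolution' (r₁ r₂ lam : ℝ) (h : ℝ → ℝ) (x : ℝ) : ℝ :=
  -(2 * besselK (r₁ - r₂) (2 * lam * √x) / x ^ ((r₁ + r₂) / 2))
      * (∫ t in Ioo 0 x, integrandI r₁ r₂ lam h t)
    - 2 * besselI |r₁ - r₂| (2 * lam * √x) / x ^ ((r₁ + r₂) / 2)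
      * (∫ t in Ioi x, integrandK r₁ r₂ lam h t)

end

noncomputable section

/-! Put s = r₁ + r₂, q = min r₁ r₂, p = max r₁ r₂ and ν = p - q. The homogeneous equation is a
modified Bessel equation in 2λ√x, with solutions u = x^(-q) A_ν(λ²x) and v = x^(-p) L_ν(λ²x). Here
A_ν is the entire factor of I_ν and L_ν(y) = ∫₀^∞ z^(ν-1) exp(-z - y/z) dz is K_ν up to a power.
Their weighted Wronskian x^(1+s) (u'v - uv') is 1 (`bessel_wronskian`).

The density of the product gamma law is a constant multiple of x^(s-1) v(x) (`productGamma_eq`,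
`productGammaDensity_eq`). Centring therefore says exactly that x^(s-1) v h̃ has integral zero, so
its integral over (0, x) is minus that over (x, ∞). This makes the two formulas agree and
compensates the growth of u at infinity.

Boundedness needs no Bessel asymptotics, only the properties collected in `RecessivePair`. Let U and
N be the primitives from 0 of t^(s-1) u h̃ and t^(s-1) v h̃, and let f = -vU + uN. Near 0, f/u tends
to 0 and (f/u)' = x^(-1-s) U/u² is O(x^(q-1)), by monotonicity of x^q u. Near infinity, the fluxes
x^(1+s) u' and -x^(1+s) v' dominate U (up to a constant) and N, and v|U| + u|N| collapses to the
Wronskian plus a bounded term.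

Since h is only measurable, U and N are differentiable only almost everywhere. But (f/u)' is
continuous, so f is differentiable everywhere; f' is absolutely continuous, and the equation holds
wherever U and N have the expected derivatives, in particular where h is continuous. For uniqueness,
constancy of Wronskians makes a difference of two solutions a combination of u and v; u is unbounded
at infinity and v at 0 (`eq_zero_of_bounded`). -/

/-- The coefficients of the entire function `besselA ν`. -/
def besselCoeff (ν : ℝ) (k : ℕ) : ℝ := 1 / (Real.Gamma (ν + k + 1) * (k.factorial : ℝ))

/-- The entire part of `I_ν`: `I_ν(z) = (z / 2) ^ ν * besselA ν (z ^ 2 / 4)`. -/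
def besselA (ν y : ℝ) : ℝ := ∑' k : ℕ, besselCoeff ν k * y ^ k

/-- The kernel of the integral representation of `K_μ`. -/
def kernelL (μ y t : ℝ) : ℝ := Real.exp (μ * t - Real.exp t - y * Real.exp (-t))

/-- `K_μ` up to a power: `2 K_μ(z) = (z / 2) ^ (-μ) * besselL μ (z ^ 2 / 4)`. -/
def besselL (μ y : ℝ) : ℝ := ∫ t : ℝ, kernelL μ y t

/-! ### The power series factor of I_ν. -/

lemma besselI_eq {ν z : ℝ} (hz : 0 < z) :
    besselI ν z = (z / 2) ^ ν * besselA ν (z ^ 2 / 4) := by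
  unfold besselI besselA besselCoeff
  rw [← tsum_mul_left]
  congr 1
  ext k
  rw [rpow_add (by positivity), mul_comm (2 : ℝ), rpow_mul (by positivity), rpow_natCast,
    show z ^ 2 / 4 = (z / 2) ^ 2 by ring]
  rw [rpow_two, ← pow_mul, ← pow_mul, mul_comm k 2]
  ring

lemma besselCoeff_pos {ν : ℝ} (hν : 0 ≤ ν) (k : ℕ) : 0 < besselCoeff ν k := by
  unfold besselCoeff
  have : 0 < Real.Gamma (ν + k + 1) := Gamma_pos_of_pos (by positivity)
  positivity

lemma Gamma_add_one_le {ν : ℝ} (hν : 0 ≤ ν) (k : ℕ) :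
    Real.Gamma (ν + 1) * k.factorial ≤ Real.Gamma (ν + k + 1) := by
  induction k with
  | zero => simp
  | succ k ih =>
    have h1 : Real.Gamma (ν + (k + 1 : ℕ) + 1) = (ν + k + 1) * Real.Gamma (ν + k + 1) := by
      rw [← Gamma_add_one (by positivity)]; push_cast; ring_nf
    have h2 : 0 < Real.Gamma (ν + k + 1) := Gamma_pos_of_pos (by positivity)
    rw [h1, Nat.factorial_succ]
    push_cast
    calc Real.Gamma (ν + 1) * ((k + 1) * k.factorial)
        = (k + 1) * (Real.Gamma (ν + 1) * k.factorial) := by ring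
      _ ≤ (k + 1) * Real.Gamma (ν + k + 1) := by gcongr
      _ ≤ (ν + k + 1) * Real.Gamma (ν + k + 1) := by
          gcongr; linarith

lemma besselCoeff_le {ν : ℝ} (hν : 0 ≤ ν) (k : ℕ) :
    besselCoeff ν k ≤ (Real.Gamma (ν + 1))⁻¹ * (k.factorial : ℝ)⁻¹ := by
  unfold besselCoeff
  have h0 : 0 < Real.Gamma (ν + 1) := Gamma_pos_of_pos (by positivity)
  have hk : (1 : ℝ) ≤ k.factorial := by exact_mod_cast Nat.one_le_iff_ne_zero.2 k.factorial_ne_zero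
  rw [one_div, ← mul_inv]
  gcongr
  exact le_trans (le_mul_of_one_le_right h0.le hk) (Gamma_add_one_le hν k)

lemma summable_besselA {ν : ℝ} (hν : 0 ≤ ν) (y : ℝ) :
    Summable fun k : ℕ => besselCoeff ν k * y ^ k := by
  refine Summable.of_norm_bounded (g := fun k : ℕ => (Real.Gamma (ν + 1))⁻¹ * (|y| ^ k / k.factorial))
    ((Real.summable_pow_div_factorial |y|).mul_left _) fun k => ?_
  rw [norm_mul, norm_pow, norm_of_nonneg (besselCoeff_pos hν k).le, Real.norm_eq_abs]
  calc _ ≤ (Real.Gamma (ν + 1))⁻¹ * (k.factorial : ℝ)⁻¹ * |y| ^ k := by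
        gcongr; exact besselCoeff_le hν k
    _ = _ := by ring

lemma besselCoeff_succ (ν : ℝ) (k : ℕ) :
    besselCoeff ν (k + 1) * (k + 1 : ℕ) = besselCoeff (ν + 1) k := by
  unfold besselCoeff
  rw [Nat.factorial_succ, show ν + (k + 1 : ℕ) + 1 = ν + 1 + k + 1 by push_cast; ring]
  push_cast
  field_simp

/-- The term k = 0 vanishes, and k cancels against k! after an index shift; so differentiation
raises the order by one. -/
lemma hasSum_deriv_besselA {ν : ℝ} (hν : 0 ≤ ν) (y : ℝ) :
    HasSum (fun k : ℕ => besselCoeff ν k * (k * y ^ (k - 1))) (besselA (ν + 1) y) := by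
  rw [← hasSum_nat_add_iff' 1]
  simp only [Finset.range_one, Finset.sum_singleton, Nat.cast_zero, zero_mul, mul_zero, sub_zero,
    Nat.add_sub_cancel, ← mul_assoc, besselCoeff_succ]
  exact (summable_besselA (by linarith) y).hasSum

lemma hasDerivAt_besselA {ν : ℝ} (hν : 0 ≤ ν) (y : ℝ) :
    HasDerivAt (besselA ν) (besselA (ν + 1) y) y := by
  rw [← (hasSum_deriv_besselA hν y).tsum_eq]
  refine hasDerivAt_tsum_of_isPreconnected (t := Ioo (-(|y| + 1)) (|y| + 1)) (y₀ := 0)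
    (hasSum_deriv_besselA hν (|y| + 1)).summable isOpen_Ioo isPreconnected_Ioo
    (fun n z _ => (hasDerivAt_pow n z).const_mul _) (fun n z hz => ?_) ?_
    (summable_besselA hν 0) ?_
  · rw [norm_mul, norm_mul, norm_pow, norm_of_nonneg (besselCoeff_pos hν n).le, norm_natCast]
    have : ‖z‖ ≤ |y| + 1 := (abs_lt.2 hz).le
    have := (besselCoeff_pos hν n).le
    gcongr
  · constructor <;> linarith [abs_nonneg y]
  · exact abs_lt.1 (by linarith)

/-- The first term is y times the derivative of the order ν + 1 series, which multiplies the k-th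
coefficient by k; the functional equation of Γ then absorbs k + ν + 1. -/
lemma besselA_recurrence {ν : ℝ} (hν : 0 ≤ ν) (y : ℝ) :
    y * besselA (ν + 2) y + (ν + 1) * besselA (ν + 1) y = besselA ν y := by
  have h1 := (hasSum_deriv_besselA (ν := ν + 1) (by linarith) y).mul_left y
  have h2 := (summable_besselA (ν := ν + 1) (by linarith) y).hasSum.mul_left (ν + 1)
  rw [show ν + 1 + 1 = ν + 2 by ring] at h1
  refine (h1.add h2).unique ?_
  convert! (summable_besselA hν y).hasSum using 1
  ext k
  have hG : Real.Gamma (ν + 1 + k + 1) = (ν + k + 1) * Real.Gamma (ν + k + 1) := by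
    rw [← Gamma_add_one (by positivity)]; ring_nf
  have h0 : 0 < Real.Gamma (ν + k + 1) := Gamma_pos_of_pos (by positivity)
  have hy : y * (k * y ^ (k - 1)) = k * y ^ k := by
    rcases k with _ | k
    · simp
    · rw [Nat.add_sub_cancel, pow_succ]; ring
  calc y * (besselCoeff (ν + 1) k * (k * y ^ (k - 1))) + (ν + 1) * (besselCoeff (ν + 1) k * y ^ k)
      = besselCoeff (ν + 1) k * (y * (k * y ^ (k - 1))) + (ν + 1) * (besselCoeff (ν + 1) k * y ^ k) := by ring
    _ = (ν + k + 1) * besselCoeff (ν + 1) k * y ^ k := by rw [hy]; ring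
    _ = _ := by
      congr 1
      unfold besselCoeff
      rw [hG]
      have : ν + k + 1 ≠ 0 := by positivity
      field_simp

lemma besselCoeff_mul_pow_le {ν y : ℝ} (hν : 0 ≤ ν) (hy : 0 ≤ y) (k : ℕ) :
    besselCoeff ν k * y ^ k ≤ besselA ν y :=
  (summable_besselA hν y).le_tsum k fun j _ => mul_nonneg (besselCoeff_pos hν j).le (pow_nonneg hy j)

lemma inv_Gamma_le_besselA {ν y : ℝ} (hν : 0 ≤ ν) (hy : 0 ≤ y) :
    (Real.Gamma (ν + 1))⁻¹ ≤ besselA ν y := by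
  simpa [besselCoeff] using besselCoeff_mul_pow_le hν hy 0

lemma besselA_pos {ν y : ℝ} (hν : 0 ≤ ν) (hy : 0 ≤ y) : 0 < besselA ν y :=
  lt_of_lt_of_le (inv_pos.2 (Gamma_pos_of_pos (by linarith))) (inv_Gamma_le_besselA hν hy)

lemma besselA_mono {ν y y' : ℝ} (hν : 0 ≤ ν) (hy : 0 ≤ y) (h : y ≤ y') :
    besselA ν y ≤ besselA ν y' := by
  refine (summable_besselA hν y).tsum_le_tsum (fun k => ?_) (summable_besselA hν y')
  have := (besselCoeff_pos hν k).le
  gcongr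

lemma besselA_zero (ν : ℝ) : besselA ν 0 = (Real.Gamma (ν + 1))⁻¹ := by
  unfold besselA
  rw [tsum_eq_single 0 (by intro k hk; simp [hk])]
  simp [besselCoeff]

/-! ### The function `besselL` -/

lemma integrable_exp_mul_comp_exp {g : ℝ → ℝ} :
    Integrable (fun t => Real.exp t * g (Real.exp t)) ↔ IntegrableOn g (Ioi 0) := by
  have := integrableOn_image_iff_integrableOn_abs_deriv_smul (s := univ) MeasurableSet.univ
    (fun x _ => (Real.hasDerivAt_exp x).hasDerivWithinAt) Real.exp_injective.injOn g
  rw [image_univ, Real.range_exp, integrableOn_univ] at this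
  simpa [abs_of_pos (Real.exp_pos _)] using this.symm

lemma integral_exp_mul_comp_exp (g : ℝ → ℝ) :
    ∫ t, Real.exp t * g (Real.exp t) = ∫ x in Ioi 0, g x := by
  have := integral_image_eq_integral_abs_deriv_smul (s := univ) MeasurableSet.univ
    (fun x _ => (Real.hasDerivAt_exp x).hasDerivWithinAt) Real.exp_injective.injOn g
  rw [image_univ, Real.range_exp, setIntegral_univ] at this
  simpa [abs_of_pos (Real.exp_pos _)] using this.symm

lemma kernelL_zero_eq (μ t : ℝ) :
    kernelL μ 0 t = Real.exp t * (Real.exp (-Real.exp t) * Real.exp t ^ (μ - 1)) := by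
  rw [kernelL, ← Real.exp_mul, ← Real.exp_add, ← Real.exp_add]
  ring_nf

lemma integrable_kernelL_zero {μ : ℝ} (hμ : 0 < μ) : Integrable (kernelL μ 0) := by
  simp_rw [funext (kernelL_zero_eq μ)]
  exact integrable_exp_mul_comp_exp.2 (GammaIntegral_convergent hμ)

lemma besselL_zero {μ : ℝ} (hμ : 0 < μ) : besselL μ 0 = Real.Gamma μ := by
  rw [Gamma_eq_integral hμ, besselL]
  simp_rw [kernelL_zero_eq]
  exact integral_exp_mul_comp_exp (fun x => Real.exp (-x) * x ^ (μ - 1))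

lemma kernelL_pos (μ y t : ℝ) : 0 < kernelL μ y t := Real.exp_pos _

lemma continuous_kernelL (μ y : ℝ) : Continuous (kernelL μ y) := by
  unfold kernelL; fun_prop

lemma kernelL_anti (μ t : ℝ) {y y' : ℝ} (h : y ≤ y') : kernelL μ y' t ≤ kernelL μ y t := by
  unfold kernelL; gcongr

lemma integrable_kernelL (μ : ℝ) {y : ℝ} (hy : 0 < y) : Integrable (kernelL μ y) := by
  -- Since exp(-w) ≤ n!/w^n with w = y exp(-t), the second exponential can be traded for a shift of
  -- μ to μ + n > 0, where the Gamma integral converges.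
  obtain ⟨n, hn⟩ := exists_nat_gt (-μ)
  refine ((integrable_kernelL_zero (μ := μ + n) (by linarith)).const_mul
    (n.factorial / y ^ n)).mono' (continuous_kernelL μ y).aestronglyMeasurable
    (Eventually.of_forall fun t => ?_)
  rw [norm_of_nonneg (kernelL_pos _ _ _).le]
  have h1 := Real.pow_div_factorial_le_exp (y * Real.exp (-t)) (by positivity) n
  have h2 : kernelL (μ + n) 0 t = kernelL μ y t * Real.exp (y * Real.exp (-t)) * Real.exp t ^ n := by
    unfold kernelL
    rw [← Real.exp_add, ← Real.exp_nat_mul, ← Real.exp_add]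
    ring_nf
  have h3 : Real.exp (-t) * Real.exp t = 1 := by rw [← Real.exp_add]; simp
  calc kernelL μ y t = n.factorial / y ^ n * (kernelL μ y t * ((y * Real.exp (-t)) ^ n / n.factorial)
          * Real.exp t ^ n) := by
        have : (y * Real.exp (-t)) ^ n * Real.exp t ^ n = y ^ n := by
          rw [← mul_pow, mul_assoc, h3, mul_one]
        have h4 : (n.factorial : ℝ) ≠ 0 := by exact_mod_cast n.factorial_ne_zero
        rw [show (n.factorial : ℝ) / y ^ n * (kernelL μ y t * ((y * Real.exp (-t)) ^ n / n.factorial)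
          * Real.exp t ^ n) = (n.factorial / n.factorial) * kernelL μ y t *
            ((y * Real.exp (-t)) ^ n * Real.exp t ^ n) / y ^ n by ring, this, div_self h4]
        field_simp
    _ ≤ n.factorial / y ^ n * kernelL (μ + n) 0 t := by
        rw [h2]
        have := (kernelL_pos μ y t).le
        gcongr

lemma besselL_pos (μ : ℝ) {y : ℝ} (hy : 0 < y) : 0 < besselL μ y :=
  integral_exp_pos (integrable_kernelL μ hy)

lemma besselL_anti (μ : ℝ) {y y' : ℝ} (hy : 0 < y) (h : y ≤ y') : besselL μ y' ≤ besselL μ y :=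
  integral_mono (integrable_kernelL μ (hy.trans_le h)) (integrable_kernelL μ hy)
    fun t => kernelL_anti μ t h

lemma hasDerivAt_besselL (μ : ℝ) {y : ℝ} (hy : 0 < y) :
    HasDerivAt (besselL μ) (-besselL (μ - 1) y) y := by
  have := (hasDerivAt_integral_of_dominated_loc_of_deriv_le (μ := volume) (F := fun y t => kernelL μ y t)
    (F' := fun y t => -kernelL (μ - 1) y t) (x₀ := y) (s := Ioi (y / 2))
    (bound := fun t => kernelL (μ - 1) (y / 2) t)
    (Ioi_mem_nhds (by linarith))
    (Eventually.of_forall fun z => (continuous_kernelL μ z).aestronglyMeasurable)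
    (integrable_kernelL μ hy) (continuous_kernelL (μ - 1) y).neg.aestronglyMeasurable
    (Eventually.of_forall fun t z hz => ?_) (integrable_kernelL _ (by linarith))
    (Eventually.of_forall fun t z _ => ?_)).2
  · rwa [integral_neg] at this
  · rw [norm_neg, norm_of_nonneg (kernelL_pos _ _ _).le]
    exact kernelL_anti _ _ (le_of_lt hz)
  · unfold kernelL
    have h := ((hasDerivAt_id z).mul_const (Real.exp (-t))).const_sub (μ * t - Real.exp t) |>.exp
    refine h.congr_deriv ?_
    simp only [id]
    rw [one_mul, mul_neg, ← Real.exp_add]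
    ring_nf

/-- The t-derivative of the kernel integrates to zero over ℝ; the factors exp(±t) it produces shift
μ by ±1. -/
lemma besselL_recurrence (μ : ℝ) {y : ℝ} (hy : 0 < y) :
    μ * besselL μ y - besselL (μ + 1) y + y * besselL (μ - 1) y = 0 := by
  have i0 := (integrable_kernelL μ hy)
  have i1 := (integrable_kernelL (μ + 1) hy)
  have i2 := (integrable_kernelL (μ - 1) hy)
  have key := integral_eq_zero_of_hasDerivAt_of_integrable (f := kernelL μ y)
    (f' := fun t => μ * kernelL μ y t - kernelL (μ + 1) y t + y * kernelL (μ - 1) y t)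
    (fun t => ?_) (((i0.const_mul μ).sub i1).add (i2.const_mul y)) i0
  · have i01 : Integrable fun t => μ * kernelL μ y t - kernelL (μ + 1) y t := (i0.const_mul μ).sub i1
    rw [integral_add i01 (i2.const_mul y),
      integral_sub (i0.const_mul μ) i1, integral_const_mul, integral_const_mul] at key
    exact key
  · have h := ((((hasDerivAt_id t).const_mul μ).sub (Real.hasDerivAt_exp t)).sub
      ((hasDerivAt_neg t).exp.const_mul y)).exp
    refine h.congr_deriv ?_
    unfold kernelL
    rw [show (μ + 1) * t - Real.exp t - y * Real.exp (-t)
      = (μ * t - Real.exp t - y * Real.exp (-t)) + t by ring,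
      show (μ - 1) * t - Real.exp t - y * Real.exp (-t)
      = (μ * t - Real.exp t - y * Real.exp (-t)) + -t by ring, Real.exp_add _ t, Real.exp_add _ (-t)]
    simp only [id, Pi.sub_apply]
    ring

lemma tendsto_besselL_zero {μ : ℝ} (hμ : 0 < μ) :
    Tendsto (besselL μ) (𝓝[>] 0) (𝓝 (Real.Gamma μ)) := by
  rw [← besselL_zero hμ]
  refine tendsto_integral_filter_of_dominated_convergence (kernelL μ 0)
    (Eventually.of_forall fun z => (continuous_kernelL μ z).aestronglyMeasurable) ?_
    (integrable_kernelL_zero hμ) (Eventually.of_forall fun t => ?_)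
  · filter_upwards [self_mem_nhdsWithin] with z hz
    refine Eventually.of_forall fun t => ?_
    rw [norm_of_nonneg (kernelL_pos _ _ _).le]
    exact kernelL_anti _ _ (le_of_lt hz)
  · have : Continuous fun y => kernelL μ y t := by unfold kernelL; fun_prop
    exact (this.tendsto 0).mono_left nhdsWithin_le_nhds

/-- Translating t by log(z/2) balances exp t and (z²/4) exp(-t) into z cosh t. Folding ℝ onto the
half-line turns exp(μt) into 2 cosh(μt). -/
lemma besselK_eq {μ z : ℝ} (hz : 0 < z) :
    2 * besselK μ z = (z / 2) ^ (-μ) * besselL μ (z ^ 2 / 4) := by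
  set c := Real.log (z / 2) with hc
  have hec : Real.exp c = z / 2 := Real.exp_log (by positivity)
  have hshift : ∀ t, kernelL μ (z ^ 2 / 4) (t + c) = (z / 2) ^ μ * Real.exp (-z * Real.cosh t + μ * t) := by
    intro t
    unfold kernelL
    rw [rpow_def_of_pos (by positivity), ← hc, ← Real.exp_add, neg_add, Real.exp_add t, Real.exp_add (-t),
      Real.exp_neg c, hec, Real.cosh_eq]
    congr 1
    field_simp
    ring
  have hint : Integrable fun t => Real.exp (-z * Real.cosh t + μ * t) := by
    have := ((integrable_kernelL μ (y := z ^ 2 / 4) (by positivity)).comp_add_right c).const_mul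
      ((z / 2) ^ (-μ))
    refine this.congr (Eventually.of_forall fun t => ?_)
    simp only [hshift]
    rw [← mul_assoc, ← rpow_add (by positivity)]
    simp
  have h1 : besselL μ (z ^ 2 / 4) = (z / 2) ^ μ * ∫ t, Real.exp (-z * Real.cosh t + μ * t) := by
    rw [besselL, ← integral_add_right_eq_self _ c, ← integral_const_mul]
    simp_rw [hshift]
  rw [h1, ← mul_assoc, ← rpow_add (by positivity), neg_add_cancel, rpow_zero, one_mul,
    ← intervalIntegral.integral_Iic_add_Ioi (b := 0) hint.integrableOn hint.integrableOn,
    ← neg_zero, ← integral_comp_neg_Ioi, neg_zero, ← integral_add _ hint.integrableOn, besselK,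
    ← integral_const_mul]
  · congr 1
    ext t
    rw [Real.cosh_neg, Real.cosh_eq (μ * t), Real.exp_add, Real.exp_add]
    ring_nf
  · exact hint.comp_neg.integrableOn

/-- The two recurrences make the derivative vanish, and the limit at 0 is Γ(ν+1)⁻¹ Γ(ν+1). -/
lemma bessel_wronskian {ν y : ℝ} (hν : 0 ≤ ν) (hy : 0 < y) :
    y * besselA (ν + 1) y * besselL ν y + besselA ν y * besselL (ν + 1) y = 1 := by
  set E : ℝ → ℝ := fun y => y * besselA (ν + 1) y * besselL ν y + besselA ν y * besselL (ν + 1) y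
    with hE
  have hderiv : ∀ y ∈ Ioi (0 : ℝ), HasDerivAt E 0 y := by
    intro y hy
    have hA := hasDerivAt_besselA hν y
    have hA1 := hasDerivAt_besselA (ν := ν + 1) (by linarith) y
    have hL := hasDerivAt_besselL ν (mem_Ioi.1 hy)
    have hL1 := hasDerivAt_besselL (ν + 1) (mem_Ioi.1 hy)
    refine ((((hasDerivAt_id y).mul hA1).mul hL).add (hA.mul hL1)).congr_deriv ?_
    have r1 := besselA_recurrence hν y
    have r2 := besselL_recurrence ν (mem_Ioi.1 hy)
    rw [show ν + 1 - 1 = ν by ring, show ν + 1 + 1 = ν + 2 by ring]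
    simp only [id, Pi.mul_apply]
    linear_combination besselL ν y * r1 - besselA (ν + 1) y * r2
  have hlim : Tendsto E (𝓝[>] 0) (𝓝 1) := by
    have hA := ((hasDerivAt_besselA hν 0).continuousAt.tendsto).mono_left
      (nhdsWithin_le_nhds (s := Ioi 0))
    have hA1 := ((hasDerivAt_besselA (ν := ν + 1) (by linarith) 0).continuousAt.tendsto).mono_left
      (nhdsWithin_le_nhds (s := Ioi 0))
    have hL1 := tendsto_besselL_zero (μ := ν + 1) (by linarith)
    have hL2 := tendsto_besselL_zero (μ := ν + 2) (by linarith)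
    -- For ν = 0 the function L_ν diverges at 0, so the recurrence at order ν + 1 is used: it
    -- expresses y L_ν through two functions whose Gamma limits cancel.
    have hyL : Tendsto (fun y => y * besselL ν y) (𝓝[>] 0) (𝓝 0) := by
      have : Tendsto (fun y => besselL (ν + 2) y - (ν + 1) * besselL (ν + 1) y) (𝓝[>] 0)
          (𝓝 (Real.Gamma (ν + 2) - (ν + 1) * Real.Gamma (ν + 1))) := hL2.sub (hL1.const_mul _)
      rw [show ν + 2 = ν + 1 + 1 by ring, Gamma_add_one (by positivity), sub_self] at this
      refine this.congr' ?_
      filter_upwards [self_mem_nhdsWithin] with y hy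
      have := besselL_recurrence (ν + 1) (mem_Ioi.1 hy)
      rw [show ν + 1 - 1 = ν by ring] at this
      linarith
    have := (hA1.mul hyL).add (hA.mul hL1)
    rw [besselA_zero ν, mul_zero, zero_add,
      inv_mul_cancel₀ (Gamma_pos_of_pos (by linarith : 0 < ν + 1)).ne'] at this
    refine this.congr fun y => ?_
    simp only [hE]; ring
  have hconst : ∀ z ∈ Ioi (0 : ℝ), E z = E y := fun z hz =>
    isOpen_Ioi.is_const_of_deriv_eq_zero isPreconnected_Ioi
      (fun z hz => (hderiv z hz).differentiableAt.differentiableWithinAt)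
      (fun z hz => (hderiv z hz).deriv) hz hy
  refine tendsto_nhds_unique (Tendsto.congr' ?_ tendsto_const_nhds) hlim
  filter_upwards [self_mem_nhdsWithin] with z hz using (hconst z hz).symm

/-! ### Absolutely continuous functions -/

lemma absolutelyContinuousOnInterval_of_deriv_bound {f f' : ℝ → ℝ} {a b C : ℝ}
    (hf : ∀ x ∈ uIcc a b, HasDerivAt f (f' x) x) (hC : ∀ x ∈ uIcc a b, |f' x| ≤ C) :
    AbsolutelyContinuousOnInterval f a b := by
  have hL : LipschitzOnWith (Real.toNNReal C) f (uIcc a b) := by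
    refine (convex_uIcc a b).lipschitzOnWith_of_nnnorm_hasDerivWithin_le
      (fun x hx => (hf x hx).hasDerivWithinAt) fun x hx => ?_
    rw [← NNReal.coe_le_coe, coe_nnnorm, Real.norm_eq_abs]
    exact (hC x hx).trans (Real.le_coe_toNNReal C)
  exact hL.absolutelyContinuousOnInterval

lemma absolutelyContinuousOnInterval_of_hasDerivAt {f f' : ℝ → ℝ} {a b : ℝ}
    (hf : ∀ x ∈ uIcc a b, HasDerivAt f (f' x) x) (hf' : ContinuousOn f' (uIcc a b)) :
    AbsolutelyContinuousOnInterval f a b := by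
  obtain ⟨C, hC⟩ := isCompact_uIcc.exists_bound_of_continuousOn hf'
  exact absolutelyContinuousOnInterval_of_deriv_bound hf hC

lemma uIcc_subset_Ioi {a b : ℝ} (ha : 0 < a) (hb : 0 < b) : uIcc a b ⊆ Ioi 0 :=
  fun _ hx => lt_of_lt_of_le (lt_min ha hb) hx.1

lemma continuousOn_weight (r : ℝ) : ContinuousOn (fun t : ℝ => t ^ r) (Ioi 0) :=
  fun _ hx => (continuousAt_rpow_const _ _ (Or.inl (ne_of_gt hx))).continuousWithinAt

lemma absolutelyContinuousOnInterval_primitive {φ : ℝ → ℝ}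
    (hφ : ∀ x, 0 < x → IntervalIntegrable φ volume 0 x) {a b : ℝ} (ha : 0 < a) (hab : a ≤ b) :
    AbsolutelyContinuousOnInterval (fun x => ∫ t in (0 : ℝ)..x, φ t) a b := by
  refine ((hφ b (ha.trans_le hab)).absolutelyContinuousOnInterval_intervalIntegral
    left_mem_uIcc).mono ?_
  rw [uIcc_of_le hab, uIcc_of_le (ha.le.trans hab)]
  exact Icc_subset_Icc_left ha.le

/-- Lebesgue differentiation on [0, n + 1] for each n, with a countable union of null sets. -/
lemma ae_hasDerivAt_primitive {φ : ℝ → ℝ}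
    (hφ : ∀ x, 0 < x → IntervalIntegrable φ volume 0 x) :
    ∀ᵐ x, 0 < x → HasDerivAt (fun x => ∫ t in (0 : ℝ)..x, φ t) (φ x) x := by
  have h : ∀ n : ℕ, ∀ᵐ x, x ∈ uIcc (0 : ℝ) (n + 1) → ∀ c ∈ uIcc (0 : ℝ) (n + 1),
      HasDerivAt (fun x => ∫ t in c..x, φ t) (φ x) x := fun n =>
    (hφ (n + 1) (by positivity)).ae_hasDerivAt_integral
  filter_upwards [ae_all_iff.2 h] with x hx hx0
  obtain ⟨n, hn⟩ := exists_nat_gt x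
  refine hx n ?_ 0 left_mem_uIcc
  rw [uIcc_of_le (by positivity)]
  exact ⟨hx0.le, by linarith⟩

lemma continuousAt_primitive {φ : ℝ → ℝ}
    (hφ : ∀ x, 0 < x → IntervalIntegrable φ volume 0 x) {x : ℝ} (hx : 0 < x) :
    ContinuousAt (fun x => ∫ t in (0 : ℝ)..x, φ t) x := by
  have := (absolutelyContinuousOnInterval_primitive hφ (a := x / 2) (b := 2 * x) (by linarith)
    (by linarith)).continuousOn
  refine this.continuousAt ?_
  rw [uIcc_of_le (by linarith)]
  exact Icc_mem_nhds (by linarith) (by linarith)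

lemma tendsto_primitive_zero {φ : ℝ → ℝ}
    (hφ : ∀ x, 0 < x → IntervalIntegrable φ volume 0 x) :
    Tendsto (fun x => ∫ t in (0 : ℝ)..x, φ t) (𝓝[>] 0) (𝓝 0) := by
  have := ((hφ 1 one_pos).absolutelyContinuousOnInterval_intervalIntegral left_mem_uIcc).continuousOn
    0 left_mem_uIcc
  rw [ContinuousWithinAt, intervalIntegral.integral_same, uIcc_of_le zero_le_one] at this
  refine this.mono_left (nhdsWithin_le_of_mem ?_)
  exact mem_of_superset (Ioo_mem_nhdsGT one_pos) Ioo_subset_Icc_self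

/-! ### Bounded solutions by variation of parameters -/

/-- `u` and `v`, with derivatives `u₁` and `v₁`, are the solutions of
`x² y'' + (1 + s) x y' + (m - l² x) y = 0` on `(0, ∞)` that are recessive at `0` and at `∞`. -/
structure RecessivePair (p q m l : ℝ) (u u₁ v v₁ : ℝ → ℝ) : Prop where
  p_pos : 0 < p
  q_pos : 0 < q
  l_pos : 0 < l
  hu : ∀ x, 0 < x → HasDerivAt u (u₁ x) x
  hu₁ : ∀ x, 0 < x →
    HasDerivAt u₁ (((l ^ 2 * x - m) * u x - (1 + (p + q)) * x * u₁ x) / x ^ 2) x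
  hv : ∀ x, 0 < x → HasDerivAt v (v₁ x) x
  hv₁ : ∀ x, 0 < x →
    HasDerivAt v₁ (((l ^ 2 * x - m) * v x - (1 + (p + q)) * x * v₁ x) / x ^ 2) x
  wronskian : ∀ x, 0 < x → x ^ (1 + (p + q)) * (u₁ x * v x - u x * v₁ x) = 1
  u_pos : ∀ x, 0 < x → 0 < u x
  v_pos : ∀ x, 0 < x → 0 < v x
  v₁_nonpos : ∀ x, 0 < x → v₁ x ≤ 0
  u_mono : ∀ t x, 0 < t → t ≤ x → t ^ q * u t ≤ x ^ q * u x
  u_lower : ∃ c, 0 < c ∧ ∀ t, 0 < t → c ≤ t ^ q * u t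
  u_top : Tendsto u atTop atTop
  v_zero : Tendsto v (𝓝[>] 0) atTop
  v_int : IntegrableOn (fun t => t ^ (p + q - 1) * v t) (Ioi 0)

namespace RecessivePair

variable {p q m l : ℝ} {u u₁ v v₁ : ℝ → ℝ}

lemma continuousOn_u (P : RecessivePair p q m l u u₁ v v₁) : ContinuousOn u (Ioi 0) :=
  fun x hx => (P.hu x hx).continuousAt.continuousWithinAt

lemma continuousOn_u₁ (P : RecessivePair p q m l u u₁ v v₁) : ContinuousOn u₁ (Ioi 0) :=
  fun x hx => (P.hu₁ x hx).continuousAt.continuousWithinAt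

lemma continuousOn_v (P : RecessivePair p q m l u u₁ v v₁) : ContinuousOn v (Ioi 0) :=
  fun x hx => (P.hv x hx).continuousAt.continuousWithinAt

lemma continuousOn_v₁ (P : RecessivePair p q m l u u₁ v v₁) : ContinuousOn v₁ (Ioi 0) :=
  fun x hx => (P.hv₁ x hx).continuousAt.continuousWithinAt

lemma ac_u (P : RecessivePair p q m l u u₁ v v₁) {a b : ℝ} (ha : 0 < a) (hb : 0 < b) :
    AbsolutelyContinuousOnInterval u a b :=
  absolutelyContinuousOnInterval_of_hasDerivAt (fun x hx => P.hu x (uIcc_subset_Ioi ha hb hx))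
    (P.continuousOn_u₁.mono (uIcc_subset_Ioi ha hb))

lemma ac_v (P : RecessivePair p q m l u u₁ v v₁) {a b : ℝ} (ha : 0 < a) (hb : 0 < b) :
    AbsolutelyContinuousOnInterval v a b :=
  absolutelyContinuousOnInterval_of_hasDerivAt (fun x hx => P.hv x (uIcc_subset_Ioi ha hb hx))
    (P.continuousOn_v₁.mono (uIcc_subset_Ioi ha hb))

lemma continuousOn_ode {y y₁ : ℝ → ℝ} (c : ℝ) (hy : ContinuousOn y (Ioi 0))
    (hy₁ : ContinuousOn y₁ (Ioi 0)) :
    ContinuousOn (fun x => ((l ^ 2 * x - m) * y x - c * x * y₁ x) / x ^ 2) (Ioi 0) := by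
  refine ContinuousOn.div ?_ (by fun_prop) fun x hx => pow_ne_zero 2 (ne_of_gt hx)
  fun_prop

lemma ac_u₁ (P : RecessivePair p q m l u u₁ v v₁) {a b : ℝ} (ha : 0 < a) (hb : 0 < b) :
    AbsolutelyContinuousOnInterval u₁ a b :=
  absolutelyContinuousOnInterval_of_hasDerivAt (fun x hx => P.hu₁ x (uIcc_subset_Ioi ha hb hx))
    ((continuousOn_ode _ P.continuousOn_u P.continuousOn_u₁).mono (uIcc_subset_Ioi ha hb))

lemma ac_v₁ (P : RecessivePair p q m l u u₁ v v₁) {a b : ℝ} (ha : 0 < a) (hb : 0 < b) :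
    AbsolutelyContinuousOnInterval v₁ a b :=
  absolutelyContinuousOnInterval_of_hasDerivAt (fun x hx => P.hv₁ x (uIcc_subset_Ioi ha hb hx))
    ((continuousOn_ode _ P.continuousOn_v P.continuousOn_v₁).mono (uIcc_subset_Ioi ha hb))

/-- The numerator of the quotient rule is minus the Wronskian. -/
lemma hasDerivAt_ratio (P : RecessivePair p q m l u u₁ v v₁) {x : ℝ} (hx : 0 < x) :
    HasDerivAt (fun x => v x / u x) (-(x ^ (-(1 + (p + q))) / u x ^ 2)) x := by
  have hu := (P.u_pos x hx).ne'
  refine ((P.hv x hx).div (P.hu x hx) hu).congr_deriv ?_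
  have hw := P.wronskian x hx
  have hX : 0 < x ^ (1 + (p + q)) := rpow_pos_of_pos hx _
  rw [rpow_neg hx.le]
  field_simp
  linear_combination -hw

lemma ratio_anti (P : RecessivePair p q m l u u₁ v v₁) {t x : ℝ} (ht : 0 < t) (htx : t ≤ x) :
    v x / u x ≤ v t / u t := by
  refine antitoneOn_of_deriv_nonpos (convex_Ioi (0 : ℝ)) (f := fun x => v x / u x)
    (fun x hx => (P.hasDerivAt_ratio hx).continuousAt.continuousWithinAt)
    (fun x hx => (P.hasDerivAt_ratio (by simpa using hx)).differentiableAt.differentiableWithinAt)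
    (fun x hx => ?_) ht (ht.trans_le htx) htx
  have hx : 0 < x := by simpa using hx
  rw [(P.hasDerivAt_ratio hx).deriv]
  have := rpow_pos_of_pos hx (-(1 + (p + q)))
  have : 0 ≤ x ^ (-(1 + (p + q))) / u x ^ 2 := by positivity
  linarith

lemma weight_u_le (P : RecessivePair p q m l u u₁ v v₁) {t x : ℝ} (ht : 0 < t) (htx : t ≤ x) :
    t ^ (p + q - 1) * u t ≤ x ^ q * u x * t ^ (p - 1) := by
  have : t ^ (p + q - 1) * u t = t ^ (p - 1) * (t ^ q * u t) := by
    rw [← mul_assoc, ← rpow_add ht]; ring_nf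
  rw [this, mul_comm]
  have := P.u_mono t x ht htx
  gcongr

lemma aesm_weight {g k : ℝ → ℝ} (r : ℝ) (hg : ContinuousOn g (Ioi 0))
    (hk : AEStronglyMeasurable k (volume.restrict (Ioi 0))) :
    AEStronglyMeasurable (fun t => t ^ r * g t * k t) (volume.restrict (Ioi 0)) :=
  (((continuousOn_weight r).mul hg).aestronglyMeasurable measurableSet_Ioi).mul hk

lemma integrableOn_u (P : RecessivePair p q m l u u₁ v v₁) {k : ℝ → ℝ} {C : ℝ}
    (hk : AEStronglyMeasurable k (volume.restrict (Ioi 0))) (hC : ∀ t, 0 < t → |k t| ≤ C)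
    {x : ℝ} (hx : 0 < x) :
    IntervalIntegrable (fun t => t ^ (p + q - 1) * u t * k t) volume 0 x := by
  have hp := P.p_pos
  have h1 : IntervalIntegrable (fun t => C * (x ^ q * u x) * t ^ (p - 1)) volume 0 x :=
    (intervalIntegral.intervalIntegrable_rpow' (by linarith)).const_mul _
  rw [intervalIntegrable_iff_integrableOn_Ioc_of_le hx.le] at h1 ⊢
  refine h1.mono' ((aesm_weight _ P.continuousOn_u hk).mono_measure
    (Measure.restrict_mono Ioc_subset_Ioi_self le_rfl)) ?_
  refine (ae_restrict_iff' measurableSet_Ioc).2 (Eventually.of_forall fun t ht => ?_)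
  have hu := (P.u_pos t ht.1).le
  have ht0 := rpow_nonneg ht.1.le (p + q - 1)
  rw [norm_mul, Real.norm_eq_abs, abs_of_nonneg (by positivity), Real.norm_eq_abs]
  calc _ ≤ t ^ (p + q - 1) * u t * C := by gcongr; exact hC t ht.1
    _ = C * (t ^ (p + q - 1) * u t) := by ring
    _ ≤ C * (x ^ q * u x * t ^ (p - 1)) := by
        exact mul_le_mul_of_nonneg_left (P.weight_u_le ht.1 ht.2) ((abs_nonneg _).trans (hC t ht.1))
    _ = _ := by ring

lemma integrableOn_v (P : RecessivePair p q m l u u₁ v v₁) {k : ℝ → ℝ} {C : ℝ}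
    (hk : AEStronglyMeasurable k (volume.restrict (Ioi 0))) (hC : ∀ t, 0 < t → |k t| ≤ C) :
    IntegrableOn (fun t => t ^ (p + q - 1) * v t * k t) (Ioi 0) := by
  refine (P.v_int.mul_const C).mono' (aesm_weight _ P.continuousOn_v hk) ?_
  refine (ae_restrict_iff' measurableSet_Ioi).2 (Eventually.of_forall fun t ht => ?_)
  have hv := (P.v_pos t ht).le
  have ht0 := rpow_nonneg (le_of_lt ht) (p + q - 1)
  rw [norm_mul, Real.norm_eq_abs, abs_of_nonneg (by positivity), Real.norm_eq_abs]
  gcongr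
  exact hC t ht

lemma intervalIntegrable_v (P : RecessivePair p q m l u u₁ v v₁) {k : ℝ → ℝ} {C : ℝ}
    (hk : AEStronglyMeasurable k (volume.restrict (Ioi 0))) (hC : ∀ t, 0 < t → |k t| ≤ C)
    {x : ℝ} (hx : 0 < x) :
    IntervalIntegrable (fun t => t ^ (p + q - 1) * v t * k t) volume 0 x := by
  rw [intervalIntegrable_iff_integrableOn_Ioc_of_le hx.le]
  exact (P.integrableOn_v hk hC).mono_set Ioc_subset_Ioi_self

end RecessivePair

/-- The primitive from `0` of `t ^ r * g t * k t`. -/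
def weightedPrimitive (r : ℝ) (g k : ℝ → ℝ) (x : ℝ) : ℝ := ∫ t in (0 : ℝ)..x, t ^ r * g t * k t

/-- Variation of parameters with both integrals starting at `0`. -/
def paramSolution (r : ℝ) (u v k : ℝ → ℝ) (x : ℝ) : ℝ :=
  -v x * weightedPrimitive r u k x + u x * weightedPrimitive r v k x

/-! ### Regularity of the variation-of-parameters solution. -/

namespace RecessivePair

variable {p q m l : ℝ} {u u₁ v v₁ : ℝ → ℝ}

/-- Writing f/u = N - (v/u)U, the almost everywhere derivatives N' and (v/u)U' cancel, leaving the
continuous function -(v/u)'U. Absolute continuity allows integrating this identity. -/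
lemma quotient_sub (P : RecessivePair p q m l u u₁ v v₁) {k : ℝ → ℝ} {C : ℝ}
    (hk : AEStronglyMeasurable k (volume.restrict (Ioi 0))) (hC : ∀ t, 0 < t → |k t| ≤ C)
    {a b : ℝ} (ha : 0 < a) (hab : a ≤ b) :
    paramSolution (p + q - 1) u v k b / u b - paramSolution (p + q - 1) u v k a / u a =
      ∫ t in a..b, t ^ (-(1 + (p + q))) / u t ^ 2 * weightedPrimitive (p + q - 1) u k t := by
  have hb := ha.trans_le hab
  have hsub := uIcc_subset_Ioi ha hb
  have hU := fun x (hx : 0 < x) => P.integrableOn_u hk hC hx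
  have hV := fun x (hx : 0 < x) => P.intervalIntegrable_v hk hC hx
  set U := weightedPrimitive (p + q - 1) u k with hUdef
  set N := weightedPrimitive (p + q - 1) v k with hNdef
  have hcont : ContinuousOn (fun t => t ^ (-(1 + (p + q))) / u t ^ 2) (Ioi 0) :=
    (continuousOn_weight _).div (P.continuousOn_u.pow 2) fun x hx => pow_ne_zero 2 (P.u_pos x hx).ne'
  have hcU : ContinuousOn U (Ioi 0) := fun x hx =>
    (continuousAt_primitive hU hx).continuousWithinAt
  have hcJ : ContinuousOn (fun t => t ^ (-(1 + (p + q))) / u t ^ 2 * U t) (Ioi 0) := hcont.mul hcU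
  have hJint : IntervalIntegrable (fun t => t ^ (-(1 + (p + q))) / u t ^ 2 * U t) volume a b :=
    (hcJ.mono hsub).intervalIntegrable
  have acU : AbsolutelyContinuousOnInterval U a b := absolutelyContinuousOnInterval_primitive hU ha hab
  have acN : AbsolutelyContinuousOnInterval N a b := absolutelyContinuousOnInterval_primitive hV ha hab
  have acρ : AbsolutelyContinuousOnInterval (fun x => v x / u x) a b :=
    absolutelyContinuousOnInterval_of_hasDerivAt (fun x hx => P.hasDerivAt_ratio (hsub hx))
      (hcont.neg.mono hsub)
  have acJ := hJint.absolutelyContinuousOnInterval_intervalIntegral (c := a) left_mem_uIcc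
  have acAll := (acN.fun_sub (acρ.fun_mul acU)).fun_sub acJ
  obtain ⟨D, hD⟩ := acAll.const_of_ae_hasDerivAt_zero (by
    filter_upwards [ae_hasDerivAt_primitive hU, ae_hasDerivAt_primitive hV,
      hJint.ae_hasDerivAt_integral] with x h1 h2 h3 hx
    have hx0 : 0 < x := hsub hx
    refine (((h2 hx0).fun_sub ((P.hasDerivAt_ratio hx0).fun_mul (h1 hx0))).fun_sub
      (h3 hx a left_mem_uIcc)).congr_deriv ?_
    have := (P.u_pos x hx0).ne'
    simp only [hUdef, weightedPrimitive]
    field_simp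
    ring)
  have ea := hD a left_mem_uIcc
  have eb := hD b right_mem_uIcc
  simp only [intervalIntegral.integral_same, sub_zero] at ea
  have hua := (P.u_pos a ha).ne'
  have hub := (P.u_pos b hb).ne'
  have q1 : paramSolution (p + q - 1) u v k b / u b = N b - v b / u b * U b := by
    rw [paramSolution, ← hUdef, ← hNdef]; field_simp; ring
  have q2 : paramSolution (p + q - 1) u v k a / u a = N a - v a / u a * U a := by
    rw [paramSolution, ← hUdef, ← hNdef]; field_simp; ring
  rw [q1, q2]
  linarith

/-- The product rule is not available at every x, because U and N need not be differentiable there.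
Instead f/u is locally a primitive of a continuous function, hence differentiable everywhere; the
Wronskian gives the expected value. -/
lemma hasDerivAt_paramSolution (P : RecessivePair p q m l u u₁ v v₁) {k : ℝ → ℝ} {C : ℝ}
    (hk : AEStronglyMeasurable k (volume.restrict (Ioi 0))) (hC : ∀ t, 0 < t → |k t| ≤ C)
    {x : ℝ} (hx : 0 < x) :
    HasDerivAt (paramSolution (p + q - 1) u v k)
      (-v₁ x * weightedPrimitive (p + q - 1) u k x + u₁ x * weightedPrimitive (p + q - 1) v k x) x := by
  set U := weightedPrimitive (p + q - 1) u k with hUdef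
  set N := weightedPrimitive (p + q - 1) v k with hNdef
  set f := paramSolution (p + q - 1) u v k with hf
  have hU := fun x (hx : 0 < x) => P.integrableOn_u hk hC hx
  have hcont : ContinuousOn (fun t => t ^ (-(1 + (p + q))) / u t ^ 2 * U t) (Ioi 0) :=
    ((continuousOn_weight _).div (P.continuousOn_u.pow 2)
      fun x hx => pow_ne_zero 2 (P.u_pos x hx).ne').mul
      fun x hx => (continuousAt_primitive hU hx).continuousWithinAt
  have hJ : HasDerivAt (fun y => ∫ t in (x / 2)..y, t ^ (-(1 + (p + q))) / u t ^ 2 * U t)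
      (x ^ (-(1 + (p + q))) / u x ^ 2 * U x) x := by
    refine intervalIntegral.integral_hasDerivAt_right
      (hcont.mono (uIcc_subset_Ioi (by linarith) hx)).intervalIntegrable ?_
      (hcont.continuousAt (Ioi_mem_nhds hx))
    exact hcont.stronglyMeasurableAtFilter isOpen_Ioi x hx
  have hG := (P.hu x hx).fun_mul (hJ.const_add (f (x / 2) / u (x / 2)))
  have hfG : f =ᶠ[𝓝 x] fun y => u y * (f (x / 2) / u (x / 2) +
      ∫ t in (x / 2)..y, t ^ (-(1 + (p + q))) / u t ^ 2 * U t) := by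
    filter_upwards [Ioi_mem_nhds (show x / 2 < x by linarith)] with y hy
    rw [← P.quotient_sub hk hC (a := x / 2) (by linarith) (le_of_lt hy)]
    have := (P.u_pos y (by linarith [mem_Ioi.1 hy])).ne'
    field_simp
    ring
  refine (hG.congr_of_eventuallyEq hfG).congr_deriv ?_
  rw [← P.quotient_sub hk hC (a := x / 2) (by linarith) (by linarith), rpow_neg hx.le,
    add_sub_cancel, ← hf, hf, paramSolution, ← hUdef, ← hNdef]
  have hw := P.wronskian x hx
  have hX : 0 < x ^ (1 + (p + q)) := rpow_pos_of_pos hx _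
  have := (P.u_pos x hx).ne'
  field_simp
  linear_combination -U x * hw

end RecessivePair

/-! ### Boundedness near zero. -/

namespace RecessivePair

variable {p q m l : ℝ} {u u₁ v v₁ : ℝ → ℝ}

lemma abs_primitive_u_le (P : RecessivePair p q m l u u₁ v v₁) {k : ℝ → ℝ} {C : ℝ}
    (hC : ∀ t, 0 < t → |k t| ≤ C) {x : ℝ} (hx : 0 < x) :
    |weightedPrimitive (p + q - 1) u k x| ≤ C * (x ^ q * u x) * (x ^ p / p) := by
  have hp := P.p_pos
  have h1 : IntervalIntegrable (fun t => C * (x ^ q * u x) * t ^ (p - 1)) volume 0 x :=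
    (intervalIntegral.intervalIntegrable_rpow' (by linarith)).const_mul _
  rw [weightedPrimitive, ← Real.norm_eq_abs]
  refine (intervalIntegral.norm_integral_le_of_norm_le hx.le
    (Eventually.of_forall fun t ht => ?_) h1).trans_eq ?_
  · have hu := (P.u_pos t ht.1).le
    have ht0 := rpow_nonneg ht.1.le (p + q - 1)
    rw [norm_mul, Real.norm_eq_abs, abs_of_nonneg (by positivity), Real.norm_eq_abs]
    calc _ ≤ t ^ (p + q - 1) * u t * C := by gcongr; exact hC t ht.1
      _ = C * (t ^ (p + q - 1) * u t) := by ring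
      _ ≤ C * (x ^ q * u x * t ^ (p - 1)) :=
          mul_le_mul_of_nonneg_left (P.weight_u_le ht.1 ht.2) ((abs_nonneg _).trans (hC t ht.1))
      _ = _ := by ring
  · rw [intervalIntegral.integral_const_mul, integral_rpow (Or.inl (by linarith)),
      sub_add_cancel, zero_rpow hp.ne', sub_zero]

/-- In f/u = N - (v/u)U the ratio v/u is decreasing, so (v/u)(x) u(t) ≤ v(t) for t ≤ x. Both terms
are thus controlled by integrals of the integrable weight t^(p+q-1) v over (0, x). -/
lemma tendsto_quotient_zero (P : RecessivePair p q m l u u₁ v v₁) {k : ℝ → ℝ} {C : ℝ}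
    (hk : AEStronglyMeasurable k (volume.restrict (Ioi 0))) (hC : ∀ t, 0 < t → |k t| ≤ C) :
    Tendsto (fun x => paramSolution (p + q - 1) u v k x / u x) (𝓝[>] 0) (𝓝 0) := by
  have hN := tendsto_primitive_zero fun x (hx : 0 < x) => P.intervalIntegrable_v hk hC hx
  have hV := fun x (hx : 0 < x) => P.intervalIntegrable_v (k := fun _ => C) (C := |C|)
    aestronglyMeasurable_const (fun _ _ => le_rfl) hx
  have hlim := hN.abs.add (tendsto_primitive_zero hV)
  rw [abs_zero, add_zero] at hlim
  refine squeeze_zero_norm' ?_ hlim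
  filter_upwards [self_mem_nhdsWithin] with x hx
  have hx : 0 < x := hx
  have hux := P.u_pos x hx
  have hq : paramSolution (p + q - 1) u v k x / u x =
      weightedPrimitive (p + q - 1) v k x + -(v x / u x * weightedPrimitive (p + q - 1) u k x) := by
    rw [paramSolution]; field_simp; ring
  rw [hq]
  refine (norm_add_le _ _).trans (add_le_add le_rfl ?_)
  rw [norm_neg, weightedPrimitive, ← intervalIntegral.integral_const_mul]
  refine intervalIntegral.norm_integral_le_of_norm_le hx.le
    (Eventually.of_forall fun t ht => ?_) (hV x hx)
  have hu := P.u_pos t ht.1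
  have hvx := P.v_pos x hx
  have ht0 := rpow_nonneg ht.1.le (p + q - 1)
  have hr := P.ratio_anti ht.1 ht.2
  rw [norm_mul, norm_mul, norm_mul, norm_of_nonneg (by positivity), norm_of_nonneg (by positivity),
    norm_of_nonneg hu.le, Real.norm_eq_abs]
  calc v x / u x * (t ^ (p + q - 1) * u t * |k t|)
      ≤ v t / u t * (t ^ (p + q - 1) * u t * C) := by
        have := hC t ht.1
        have hvt := P.v_pos t ht.1
        gcongr
    _ = t ^ (p + q - 1) * v t * C := by field_simp

lemma bounded_near_zero (P : RecessivePair p q m l u u₁ v v₁) {k : ℝ → ℝ} {C : ℝ}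
    (hk : AEStronglyMeasurable k (volume.restrict (Ioi 0))) (hC : ∀ t, 0 < t → |k t| ≤ C) (x₀ : ℝ) :
    ∃ B, ∀ x, 0 < x → x ≤ x₀ → |paramSolution (p + q - 1) u v k x| ≤ B := by
  obtain ⟨c, hc, hcu⟩ := P.u_lower
  have hp := P.p_pos
  have hq := P.q_pos
  have hC0 : 0 ≤ C := (abs_nonneg _).trans (hC 1 one_pos)
  set G := fun x => paramSolution (p + q - 1) u v k x / u x with hG
  -- The bound on U reduces the integrand of `quotient_sub` to (C/p) t^(-1)/u, and u ≥ c t^(-q)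
  -- makes it integrable at 0. Letting a tend to 0 afterwards bounds G itself.
  have hint : ∀ a b, 0 < a → a ≤ b → |G b - G a| ≤ C / (p * c) * (b ^ q / q) := by
    intro a b ha hab
    rw [hG, P.quotient_sub hk hC ha hab, ← Real.norm_eq_abs]
    have hi : IntervalIntegrable (fun t : ℝ => C / (p * c) * t ^ (q - 1)) volume a b :=
      (intervalIntegral.intervalIntegrable_rpow' (by linarith)).const_mul _
    refine (intervalIntegral.norm_integral_le_of_norm_le hab
      (Eventually.of_forall fun t ht => ?_) hi).trans ?_
    · have ht0 : 0 < t := ha.trans ht.1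
      have hu := P.u_pos t ht0
      have htp := rpow_pos_of_pos ht0 (-(1 + (p + q)))
      rw [norm_mul, norm_of_nonneg (by positivity), Real.norm_eq_abs]
      calc t ^ (-(1 + (p + q))) / u t ^ 2 * |weightedPrimitive (p + q - 1) u k t|
          ≤ t ^ (-(1 + (p + q))) / u t ^ 2 * (C * (t ^ q * u t) * (t ^ p / p)) := by
            gcongr; exact P.abs_primitive_u_le hC ht0
        _ = C / p * (t ^ (-(1 + (p + q))) * t ^ q * t ^ p) / u t := by field_simp
        _ = C / p * t ^ (-1 : ℝ) / u t := by
            rw [← rpow_add ht0, ← rpow_add ht0]; ring_nf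
        _ ≤ C / p * t ^ (-1 : ℝ) / (c / t ^ q) := by
            have htq := rpow_pos_of_pos ht0 q
            have ht1 := rpow_pos_of_pos ht0 (-1)
            gcongr
            rw [div_le_iff₀ htq, mul_comm]
            exact hcu t ht0
        _ = C / (p * c) * (t ^ (-1 : ℝ) * t ^ q) := by field_simp
        _ = _ := by rw [← rpow_add ht0]; ring_nf
    · rw [intervalIntegral.integral_const_mul, integral_rpow (Or.inl (by linarith)), sub_add_cancel]
      have := rpow_nonneg ha.le q
      gcongr
      linarith
  refine ⟨C / (p * c * q) * (x₀ ^ q * u x₀), fun x hx hxx => ?_⟩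
  have hGx : |G x| ≤ C / (p * c) * (x ^ q / q) := by
    have h0 : Tendsto (fun a => |G x - G a|) (𝓝[>] 0) (𝓝 |G x - 0|) :=
      ((P.tendsto_quotient_zero hk hC).const_sub _).abs
    rw [sub_zero] at h0
    refine le_of_tendsto h0 ?_
    filter_upwards [Ioc_mem_nhdsGT hx] with a ha using hint a x ha.1 ha.2
  have hux := P.u_pos x hx
  calc |paramSolution (p + q - 1) u v k x| = |G x| * u x := by
        rw [hG, abs_div, abs_of_pos hux, div_mul_cancel₀ _ hux.ne']
    _ ≤ C / (p * c) * (x ^ q / q) * u x := by gcongr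
    _ = C / (p * c * q) * (x ^ q * u x) := by field_simp
    _ ≤ _ := mul_le_mul_of_nonneg_left (P.u_mono x x₀ hx hxx) (by positivity)

/-! ### Boundedness at infinity through the self-adjoint form of the equation. -/

lemma hasDerivAt_flux {s : ℝ} {y y₁ : ℝ → ℝ} {x : ℝ} (hx : 0 < x)
    (h : HasDerivAt y₁ (((l ^ 2 * x - m) * y x - (1 + s) * x * y₁ x) / x ^ 2) x) :
    HasDerivAt (fun x => x ^ (1 + s) * y₁ x) (x ^ (s - 1) * ((l ^ 2 * x - m) * y x)) x := by
  refine ((hasDerivAt_rpow_const (p := 1 + s) (Or.inl hx.ne')).fun_mul h).congr_deriv ?_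
  rw [show 1 + s = (s - 1) + 2 by ring, rpow_add hx, show s - 1 + 2 - 1 = (s - 1) + 1 by ring,
    rpow_add hx, rpow_one, rpow_two]
  field_simp
  ring

/-- Once l²x - m ≥ 1, the weight t^(s-1) y is at most the derivative of the flux t^(1+s) y'. -/
lemma integral_weight_le_flux {s x₀ a b : ℝ} {y y₁ : ℝ → ℝ}
    (hy : ContinuousOn y (Ioi 0)) (hpos : ∀ x, 0 < x → 0 < y x)
    (h : ∀ x, 0 < x → HasDerivAt y₁ (((l ^ 2 * x - m) * y x - (1 + s) * x * y₁ x) / x ^ 2) x)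
    (hx₀ : 0 < x₀) (hbig : ∀ x, x₀ ≤ x → 1 ≤ l ^ 2 * x - m) (ha : x₀ ≤ a) (hab : a ≤ b) :
    ∫ t in a..b, t ^ (s - 1) * y t ≤ b ^ (1 + s) * y₁ b - a ^ (1 + s) * y₁ a := by
  have ha0 : 0 < a := hx₀.trans_le ha
  have hsub := uIcc_subset_Ioi ha0 (ha0.trans_le hab)
  have hc2 : ContinuousOn (fun t => t ^ (s - 1) * ((l ^ 2 * t - m) * y t)) (Ioi 0) :=
    (continuousOn_weight _).mul (by fun_prop)
  rw [← intervalIntegral.integral_eq_sub_of_hasDerivAt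
    (fun x hx => hasDerivAt_flux (hsub hx) (h x (hsub hx))) (hc2.mono hsub).intervalIntegrable]
  refine intervalIntegral.integral_mono_on hab
    (((continuousOn_weight _).mul hy).mono hsub).intervalIntegrable
    (hc2.mono hsub).intervalIntegrable fun t ht => ?_
  have ht0 : 0 < t := ha0.trans_le ht.1
  have := rpow_nonneg ht0.le (s - 1)
  have := hpos t ht0
  gcongr
  nlinarith [hbig t (ha.trans ht.1)]

lemma v_anti (P : RecessivePair p q m l u u₁ v v₁) {t x : ℝ} (ht : 0 < t) (htx : t ≤ x) :
    v x ≤ v t := by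
  refine antitoneOn_of_deriv_nonpos (convex_Ioi (0 : ℝ)) P.continuousOn_v
    (fun x hx => (P.hv x (by simpa using hx)).differentiableAt.differentiableWithinAt)
    (fun x hx => ?_) ht (ht.trans_le htx) htx
  have hx : 0 < x := by simpa using hx
  rw [(P.hv x hx).deriv]
  exact P.v₁_nonpos x hx

lemma primitive_v_eq (P : RecessivePair p q m l u u₁ v v₁) {k : ℝ → ℝ} {C : ℝ}
    (hk : AEStronglyMeasurable k (volume.restrict (Ioi 0))) (hC : ∀ t, 0 < t → |k t| ≤ C)
    (hzero : ∫ t in Ioi (0 : ℝ), t ^ (p + q - 1) * v t * k t = 0) {x : ℝ} (hx : 0 < x) :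
    weightedPrimitive (p + q - 1) v k x = -∫ t in Ioi x, t ^ (p + q - 1) * v t * k t := by
  have hi := P.integrableOn_v hk hC
  rw [← Ioc_union_Ioi_eq_Ioi hx.le, setIntegral_union (Ioc_disjoint_Ioi le_rfl) measurableSet_Ioi
    (hi.mono_set Ioc_subset_Ioi_self) (hi.mono_set (Ioi_subset_Ioi hx.le))] at hzero
  rw [weightedPrimitive, intervalIntegral.integral_of_le hx.le]
  linarith

lemma bounded_at_top (P : RecessivePair p q m l u u₁ v v₁) {k : ℝ → ℝ} {C : ℝ}
    (hk : AEStronglyMeasurable k (volume.restrict (Ioi 0))) (hC : ∀ t, 0 < t → |k t| ≤ C)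
    (hzero : ∫ t in Ioi (0 : ℝ), t ^ (p + q - 1) * v t * k t = 0) :
    ∃ x₀ B, 0 < x₀ ∧ ∀ x, x₀ ≤ x → |paramSolution (p + q - 1) u v k x| ≤ B := by
  have hl := P.l_pos
  have hC0 : 0 ≤ C := (abs_nonneg _).trans (hC 1 one_pos)
  set x₀ := (|m| + 1) / l ^ 2 with hx₀def
  have hx₀ : 0 < x₀ := by positivity
  have hbig : ∀ x, x₀ ≤ x → 1 ≤ l ^ 2 * x - m := by
    intro x hx
    rw [hx₀def, div_le_iff₀ (by positivity)] at hx
    linarith [le_abs_self m]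
  set U := weightedPrimitive (p + q - 1) u k with hUdef
  set N := weightedPrimitive (p + q - 1) v k with hNdef
  have hN : ∀ x, x₀ ≤ x → |N x| ≤ C * -(x ^ (1 + (p + q)) * v₁ x) := by
    intro x hx
    have hx0 := hx₀.trans_le hx
    have hvi : IntegrableOn (fun t => t ^ (p + q - 1) * v t) (Ioi x) :=
      P.v_int.mono_set (Ioi_subset_Ioi hx0.le)
    have htail : ∫ t in Ioi x, t ^ (p + q - 1) * v t ≤ -(x ^ (1 + (p + q)) * v₁ x) := by
      refine le_of_tendsto (intervalIntegral_tendsto_integral_Ioi x hvi tendsto_id) ?_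
      filter_upwards [eventually_ge_atTop x] with R hR
      refine (integral_weight_le_flux P.continuousOn_v P.v_pos P.hv₁ hx₀ hbig hx hR).trans ?_
      -- The flux of v at the far end R is nonpositive and can be dropped, so no limit of it is
      -- needed.
      have h1 := P.v₁_nonpos R (hx0.trans_le hR)
      have h2 := rpow_nonneg (hx0.trans_le hR).le (1 + (p + q))
      nlinarith
    rw [hNdef, P.primitive_v_eq hk hC hzero hx0, abs_neg, ← Real.norm_eq_abs]
    calc _ ≤ ∫ t in Ioi x, C * (t ^ (p + q - 1) * v t) := by
          refine norm_integral_le_of_norm_le (hvi.const_mul C) ?_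
          refine (ae_restrict_iff' measurableSet_Ioi).2 (Eventually.of_forall fun t ht => ?_)
          have ht0 : 0 < t := hx0.trans ht
          have hv := (P.v_pos t ht0).le
          have ht1 := rpow_nonneg ht0.le (p + q - 1)
          rw [norm_mul, norm_of_nonneg (by positivity), mul_comm C, Real.norm_eq_abs]
          gcongr
          exact hC t ht0
      _ ≤ _ := by
          rw [integral_const_mul]
          gcongr
  have hUb : ∀ x, x₀ ≤ x →
      |U x| ≤ |U x₀| + C * |x₀ ^ (1 + (p + q)) * u₁ x₀| + C * (x ^ (1 + (p + q)) * u₁ x) := by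
    intro x hx
    have hx0 := hx₀.trans_le hx
    have hi := fun x (hx : 0 < x) => P.integrableOn_u hk hC hx
    have hsplit : U x = U x₀ + ∫ t in x₀..x, t ^ (p + q - 1) * u t * k t := by
      rw [hUdef, weightedPrimitive, weightedPrimitive, intervalIntegral.integral_add_adjacent_intervals
        (hi x₀ hx₀) ((hi x₀ hx₀).symm.trans (hi x hx0))]
    have hci : IntervalIntegrable (fun t => C * (t ^ (p + q - 1) * u t)) volume x₀ x :=
      ((((continuousOn_weight _).mul P.continuousOn_u).mono
        (uIcc_subset_Ioi hx₀ hx0)).intervalIntegrable).const_mul C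
    have h1 : |∫ t in x₀..x, t ^ (p + q - 1) * u t * k t| ≤
        C * (x ^ (1 + (p + q)) * u₁ x - x₀ ^ (1 + (p + q)) * u₁ x₀) := by
      calc _ ≤ ∫ t in x₀..x, C * (t ^ (p + q - 1) * u t) := by
            rw [← Real.norm_eq_abs]
            refine intervalIntegral.norm_integral_le_of_norm_le hx
              (Eventually.of_forall fun t ht => ?_) hci
            have ht0 : 0 < t := hx₀.trans ht.1
            have hv := (P.u_pos t ht0).le
            have ht1 := rpow_nonneg ht0.le (p + q - 1)
            rw [norm_mul, norm_of_nonneg (by positivity), mul_comm C, Real.norm_eq_abs]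
            gcongr
            exact hC t ht0
        _ ≤ _ := by
            rw [intervalIntegral.integral_const_mul]
            gcongr
            exact integral_weight_le_flux P.continuousOn_u P.u_pos P.hu₁ hx₀ hbig le_rfl hx
    rw [hsplit]
    refine (abs_add_le _ _).trans ?_
    have h2 := mul_le_mul_of_nonneg_left (neg_abs_le (x₀ ^ (1 + (p + q)) * u₁ x₀)) hC0
    linarith
  refine ⟨x₀, v x₀ * (|U x₀| + C * |x₀ ^ (1 + (p + q)) * u₁ x₀|) + C, hx₀, fun x hx => ?_⟩
  have hx0 := hx₀.trans_le hx
  have hu := P.u_pos x hx0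
  have hv := P.v_pos x hx0
  have hw := P.wronskian x hx0
  calc |paramSolution (p + q - 1) u v k x| ≤ v x * |U x| + u x * |N x| := by
        rw [paramSolution]
        refine (abs_add_le _ _).trans_eq ?_
        rw [abs_mul, abs_mul, abs_neg, abs_of_pos hu, abs_of_pos hv]
    _ ≤ v x * (|U x₀| + C * |x₀ ^ (1 + (p + q)) * u₁ x₀| + C * (x ^ (1 + (p + q)) * u₁ x)) +
        u x * (C * -(x ^ (1 + (p + q)) * v₁ x)) := by
        gcongr
        · exact hUb x hx
        · exact hN x hx
    -- The two flux terms, multiplied by v and u, add up to C times the Wronskian identity.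
    _ = v x * (|U x₀| + C * |x₀ ^ (1 + (p + q)) * u₁ x₀|) + C := by linear_combination C * hw
    _ ≤ _ := by
        gcongr
        exact P.v_anti hx₀ hx

lemma bounded_paramSolution (P : RecessivePair p q m l u u₁ v v₁) {k : ℝ → ℝ} {C : ℝ}
    (hk : AEStronglyMeasurable k (volume.restrict (Ioi 0))) (hC : ∀ t, 0 < t → |k t| ≤ C)
    (hzero : ∫ t in Ioi (0 : ℝ), t ^ (p + q - 1) * v t * k t = 0) :
    BoundedOnPos (paramSolution (p + q - 1) u v k) := by
  obtain ⟨x₀, B, _, hB⟩ := P.bounded_at_top hk hC hzero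
  obtain ⟨B', hB'⟩ := P.bounded_near_zero hk hC x₀
  refine ⟨max B B', fun x hx => ?_⟩
  rcases le_total x x₀ with h | h
  · exact (hB' x hx h).trans (le_max_right _ _)
  · exact (hB x h).trans (le_max_left _ _)

/-- The terms in U and N reproduce the homogeneous equation, while those in k combine through the
Wronskian to k/x². -/
lemma hasDerivAt_deriv_paramSolution (P : RecessivePair p q m l u u₁ v v₁) {k : ℝ → ℝ} {C : ℝ}
    (hk : AEStronglyMeasurable k (volume.restrict (Ioi 0))) (hC : ∀ t, 0 < t → |k t| ≤ C)
    {x : ℝ} (hx : 0 < x)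
    (hU : HasDerivAt (weightedPrimitive (p + q - 1) u k) (x ^ (p + q - 1) * u x * k x) x)
    (hN : HasDerivAt (weightedPrimitive (p + q - 1) v k) (x ^ (p + q - 1) * v x * k x) x) :
    HasDerivAt (deriv (paramSolution (p + q - 1) u v k))
      ((k x + (l ^ 2 * x - m) * paramSolution (p + q - 1) u v k x
        - (1 + (p + q)) * x * deriv (paramSolution (p + q - 1) u v k) x) / x ^ 2) x := by
  have hE : deriv (paramSolution (p + q - 1) u v k) =ᶠ[𝓝 x] fun x =>
      -v₁ x * weightedPrimitive (p + q - 1) u k x + u₁ x * weightedPrimitive (p + q - 1) v k x := by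
    filter_upwards [Ioi_mem_nhds hx] with y hy using (P.hasDerivAt_paramSolution hk hC hy).deriv
  rw [hE.eq_of_nhds]
  refine HasDerivAt.congr_of_eventuallyEq ?_ hE
  refine (((P.hv₁ x hx).fun_neg.fun_mul hU).fun_add ((P.hu₁ x hx).fun_mul hN)).congr_deriv ?_
  have hw := P.wronskian x hx
  rw [show 1 + (p + q) = (p + q - 1) + 2 by ring, rpow_add hx, rpow_two] at hw
  rw [paramSolution]
  field_simp
  linear_combination k x * hw

lemma ac_deriv_paramSolution (P : RecessivePair p q m l u u₁ v v₁) {k : ℝ → ℝ} {C : ℝ}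
    (hk : AEStronglyMeasurable k (volume.restrict (Ioi 0))) (hC : ∀ t, 0 < t → |k t| ≤ C)
    {a b : ℝ} (ha : 0 < a) (hab : a ≤ b) :
    AbsolutelyContinuousOnInterval (fun x => -v₁ x * weightedPrimitive (p + q - 1) u k x +
      u₁ x * weightedPrimitive (p + q - 1) v k x) a b := by
  have hb := ha.trans_le hab
  have hU := absolutelyContinuousOnInterval_primitive (fun x hx => P.integrableOn_u hk hC hx) ha hab
  have hN := absolutelyContinuousOnInterval_primitive
    (fun x hx => P.intervalIntegrable_v hk hC hx) ha hab
  exact ((P.ac_v₁ ha hb).fun_neg.fun_mul hU).fun_add ((P.ac_u₁ ha hb).fun_mul hN)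

/-! ### Uniqueness -/

/-- Abel's identity for a Carathéodory solution w: the flux derivatives cancel almost everywhere,
and absolute continuity upgrades this to constancy. -/
lemma wronskian_const {s : ℝ} {w w₁ y y₁ : ℝ → ℝ}
    (hw : ∀ x, 0 < x → HasDerivAt w (w₁ x) x)
    (hac : ∀ a b, 0 < a → a ≤ b → AbsolutelyContinuousOnInterval w₁ a b)
    (hw₁ : ∀ᵐ x, 0 < x →
      HasDerivAt w₁ (((l ^ 2 * x - m) * w x - (1 + s) * x * w₁ x) / x ^ 2) x)
    (hy : ∀ x, 0 < x → HasDerivAt y (y₁ x) x)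
    (hy₁ : ∀ x, 0 < x →
      HasDerivAt y₁ (((l ^ 2 * x - m) * y x - (1 + s) * x * y₁ x) / x ^ 2) x) :
    ∃ D, ∀ x, 0 < x → x ^ (1 + s) * (w₁ x * y x - w x * y₁ x) = D := by
  set W := fun x => x ^ (1 + s) * w₁ x * y x - w x * (x ^ (1 + s) * y₁ x) with hW
  have key : ∀ a b, 0 < a → a ≤ b → W a = W b := by
    intro a b ha hab
    have hb := ha.trans_le hab
    have hsub := uIcc_subset_Ioi ha hb
    have c1 : ContinuousOn y (Ioi 0) := fun x hx => (hy x hx).continuousAt.continuousWithinAt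
    have c2 : ContinuousOn y₁ (Ioi 0) := fun x hx => (hy₁ x hx).continuousAt.continuousWithinAt
    have acy : AbsolutelyContinuousOnInterval y a b :=
      absolutelyContinuousOnInterval_of_hasDerivAt (fun x hx => hy x (hsub hx)) (c2.mono hsub)
    have acy₁ : AbsolutelyContinuousOnInterval (fun x => x ^ (1 + s) * y₁ x) a b :=
      absolutelyContinuousOnInterval_of_hasDerivAt
        (fun x hx => hasDerivAt_flux (hsub hx) (hy₁ x (hsub hx)))
        (ContinuousOn.mono ((continuousOn_weight (s - 1)).mul (by fun_prop)) hsub)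
    have acw : AbsolutelyContinuousOnInterval w a b :=
      absolutelyContinuousOnInterval_of_hasDerivAt (fun x hx => hw x (hsub hx))
        (hac a b ha hab).continuousOn
    have acp : AbsolutelyContinuousOnInterval (fun x : ℝ => x ^ (1 + s)) a b :=
      absolutelyContinuousOnInterval_of_hasDerivAt
        (fun x hx => hasDerivAt_rpow_const (Or.inl (ne_of_gt (hsub hx))))
        (((continuousOn_weight (1 + s - 1)).const_mul (1 + s)).mono hsub)
    obtain ⟨D, hD⟩ := (((acp.fun_mul (hac a b ha hab)).fun_mul acy).fun_sub
      (acw.fun_mul acy₁)).const_of_ae_hasDerivAt_zero (by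
        filter_upwards [hw₁] with x hx hxm
        have hx0 : 0 < x := hsub hxm
        refine (((hasDerivAt_flux hx0 (hx hx0)).fun_mul (hy x hx0)).fun_sub
          ((hw x hx0).fun_mul (hasDerivAt_flux hx0 (hy₁ x hx0)))).congr_deriv ?_
        ring)
    exact (hD a left_mem_uIcc).trans (hD b right_mem_uIcc).symm
  refine ⟨W 1, fun x hx => ?_⟩
  have : W x = W 1 := by
    rcases le_total x 1 with h | h
    · exact key x 1 hx h
    · exact (key 1 x one_pos h).symm
  rw [← this, hW]
  ring

lemma eq_zero_of_bounded (P : RecessivePair p q m l u u₁ v v₁) {w w₁ : ℝ → ℝ}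
    (hw : ∀ x, 0 < x → HasDerivAt w (w₁ x) x)
    (hac : ∀ a b, 0 < a → a ≤ b → AbsolutelyContinuousOnInterval w₁ a b)
    (hw₁ : ∀ᵐ x, 0 < x →
      HasDerivAt w₁ (((l ^ 2 * x - m) * w x - (1 + (p + q)) * x * w₁ x) / x ^ 2) x)
    (hb : BoundedOnPos w) {x : ℝ} (hx : 0 < x) : w x = 0 := by
  obtain ⟨α, hα⟩ := wronskian_const hw hac hw₁ P.hu P.hu₁
  obtain ⟨β, hβ⟩ := wronskian_const hw hac hw₁ P.hv P.hv₁
  obtain ⟨C, hC⟩ := hb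
  -- Eliminate w₁ from the two constant Wronskians; the coefficient of w left over is the normalised
  -- Wronskian of u and v.
  have hrep : ∀ x, 0 < x → w x = β * u x - α * v x := by
    intro x hx
    linear_combination u x * hβ x hx - v x * hα x hx - w x * P.wronskian x hx
  have hβ0 : β = 0 := by
    by_contra h
    obtain ⟨x, h1, h2⟩ := ((P.u_top.eventually_gt_atTop ((C + |α| * v 1) / |β|)).and
      (eventually_ge_atTop 1)).exists
    rw [div_lt_iff₀ (abs_pos.2 h)] at h1
    have hx : 0 < x := one_pos.trans_le h2
    have h3 : |β * u x| ≤ C + |α| * v 1 := by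
      rw [show β * u x = w x + α * v x by rw [hrep x hx]; ring]
      refine (abs_add_le _ _).trans (add_le_add (hC x hx) ?_)
      rw [abs_mul, abs_of_pos (P.v_pos x hx)]
      have := P.v_anti one_pos h2
      gcongr
    rw [abs_mul, abs_of_pos (P.u_pos x hx)] at h3
    linarith
  have hα0 : α = 0 := by
    by_contra h
    obtain ⟨x, h1, h2⟩ := ((P.v_zero.eventually_gt_atTop (C / |α|)).and
      self_mem_nhdsWithin).exists
    rw [div_lt_iff₀ (abs_pos.2 h)] at h1
    have h3 := hC x h2
    rw [hrep x h2, hβ0, zero_mul, zero_sub, abs_neg, abs_mul, abs_of_pos (P.v_pos x h2)] at h3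
    linarith
  rw [hrep x hx, hα0, hβ0]
  ring

end RecessivePair

/-! ### The density of the product gamma distribution -/

lemma continuousOn_besselL (μ : ℝ) : ContinuousOn (besselL μ) (Ioi 0) :=
  fun _ hy => (hasDerivAt_besselL μ hy).continuousAt.continuousWithinAt

/-- The density of `productGamma` on `(0, ∞)`. -/
def productGammaDensity (r₁ r₂ lam x : ℝ) : ℝ :=
  lam ^ r₁ / Real.Gamma r₁ * (lam ^ r₂ / Real.Gamma r₂) *
    (x ^ (r₂ - 1) * (lam ^ (-(r₁ - r₂)) * besselL (r₁ - r₂) (lam ^ 2 * x)))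

lemma productGammaDensity_pos {r₁ r₂ lam x : ℝ} (hr₁ : 0 < r₁) (hr₂ : 0 < r₂) (hlam : 0 < lam)
    (hx : 0 < x) : 0 < productGammaDensity r₁ r₂ lam x := by
  have := besselL_pos (r₁ - r₂) (y := lam ^ 2 * x) (by positivity)
  unfold productGammaDensity
  positivity

lemma lintegral_mul_left_real {Φ : ℝ → ENNReal} (hΦ : Measurable Φ) {a : ℝ} (ha : 0 < a) :
    ∫⁻ y, Φ (a * y) = ENNReal.ofReal a⁻¹ * ∫⁻ x, Φ x := by
  have h := lintegral_map (μ := volume) hΦ (measurable_const_mul a)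
  rw [Real.map_volume_mul_left ha.ne', lintegral_smul_measure, abs_of_pos (inv_pos.2 ha)] at h
  exact h.symm

/-- The multiplicative convolution of the two gamma densities. The substitution y = exp(t)/λ turns
-λy - λx/y into -exp t - λ²x exp(-t), the exponent of `kernelL`. -/
lemma lintegral_gammaPDF_mul {r₁ r₂ lam x : ℝ} (hr₁ : 0 < r₁) (hr₂ : 0 < r₂) (hlam : 0 < lam)
    (hx : 0 < x) :
    ∫⁻ y in Ioi 0, gammaPDF r₁ lam y * (ENNReal.ofReal y⁻¹ * gammaPDF r₂ lam (x / y)) =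
      ENNReal.ofReal (productGammaDensity r₁ r₂ lam x) := by
  have himg : Ioi (0 : ℝ) = (fun t => Real.exp (t - Real.log lam)) '' univ := by
    ext z
    simp only [mem_Ioi, image_univ, mem_range]
    refine ⟨fun hz => ⟨Real.log z + Real.log lam, ?_⟩, ?_⟩
    · rw [add_sub_cancel_right, Real.exp_log hz]
    · rintro ⟨t, rfl⟩; exact Real.exp_pos _
  rw [himg, lintegral_image_eq_lintegral_abs_deriv_mul MeasurableSet.univ
    (fun t _ => (((hasDerivAt_id' t).sub_const (Real.log lam)).exp).hasDerivWithinAt)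
    (fun t _ t' _ h => by simpa using h), setLIntegral_univ]
  have hL : productGammaDensity r₁ r₂ lam x = ∫ t, lam ^ r₁ / Real.Gamma r₁ *
      (lam ^ r₂ / Real.Gamma r₂) * (x ^ (r₂ - 1) * (lam ^ (-(r₁ - r₂)) *
        kernelL (r₁ - r₂) (lam ^ 2 * x) t)) := by
    rw [integral_const_mul, integral_const_mul, integral_const_mul]; rfl
  rw [hL, ofReal_integral_eq_lintegral_ofReal]
  · refine lintegral_congr fun t => ?_
    set y := Real.exp (t - Real.log lam) with hy
    have hy0 : 0 < y := Real.exp_pos _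
    have hxy : 0 < x / y := by positivity
    rw [gammaPDF_of_nonneg hy0.le, gammaPDF_of_nonneg hxy.le]
    rw [← ENNReal.ofReal_mul (by positivity), ← ENNReal.ofReal_mul (by positivity),
      ← ENNReal.ofReal_mul (by positivity)]
    congr 1
    rw [mul_one, abs_of_pos hy0, div_rpow hx.le hy0.le]
    have e1 : lam * y = Real.exp t := by rw [hy, Real.exp_sub, Real.exp_log hlam]; field_simp
    have e2 : lam * (x / y) = lam ^ 2 * x * Real.exp (-t) := by
      rw [Real.exp_neg, ← e1]; field_simp
    have e3 : kernelL (r₁ - r₂) (lam ^ 2 * x) t = (lam * y) ^ (r₁ - r₂) *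
        Real.exp (-(lam * y)) * Real.exp (-(lam * (x / y))) := by
      rw [e1, e2, kernelL, ← Real.exp_mul, ← Real.exp_add, ← Real.exp_add]
      ring_nf
    have e4 : y ^ (r₁ - 1) = y ^ (r₁ - r₂) * y ^ (r₂ - 1) := by
      rw [← rpow_add hy0]; ring_nf
    have h5 : 0 < y ^ (r₂ - 1) := rpow_pos_of_pos hy0 _
    have h6 : 0 < lam ^ (r₁ - r₂) := rpow_pos_of_pos hlam _
    rw [e3, mul_rpow hlam.le hy0.le, rpow_neg hlam.le, e4]
    have h7 := (Gamma_pos_of_pos hr₁).ne'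
    have h8 := (Gamma_pos_of_pos hr₂).ne'
    field_simp
  · exact ((((integrable_kernelL _ (by positivity)).const_mul _).const_mul _).const_mul _)
  · refine Eventually.of_forall fun t => ?_
    have := (kernelL_pos (r₁ - r₂) (lam ^ 2 * x) t).le
    simp only [Pi.zero_apply]
    positivity

lemma productGamma_eq {r₁ r₂ lam : ℝ} (hr₁ : 0 < r₁) (hr₂ : 0 < r₂) (hlam : 0 < lam) :
    productGamma r₁ r₂ lam = (volume.restrict (Ioi 0)).withDensity
      (fun x => ENNReal.ofReal (productGammaDensity r₁ r₂ lam x)) := by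
  have := isProbabilityMeasure_gammaMeasure hr₁ hlam
  have := isProbabilityMeasure_gammaMeasure hr₂ hlam
  have hg : ∀ r, Measurable (gammaPDF r lam) := fun r =>
    (measurable_gammaPDFReal r lam).ennreal_ofReal
  have hdens : AEMeasurable (fun x => ENNReal.ofReal (productGammaDensity r₁ r₂ lam x))
      (volume.restrict (Ioi 0)) := by
    refine AEMeasurable.ennreal_ofReal (ContinuousOn.aemeasurable ?_ measurableSet_Ioi)
    refine continuousOn_const.mul ((continuousOn_weight _).mul (continuousOn_const.mul ?_))
    exact (continuousOn_besselL _).comp (by fun_prop) fun x hx =>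
      mul_pos (by positivity) (mem_Ioi.1 hx)
  refine Measure.ext_of_lintegral _ fun F hF => ?_
  rw [productGamma, lintegral_map hF (by fun_prop),
    lintegral_prod (fun p : ℝ × ℝ => F (p.1 * p.2))
      (hF.comp (by fun_prop : Measurable fun p : ℝ × ℝ => p.1 * p.2)).aemeasurable]
  have hinner : ∀ y : ℝ, ∫⁻ z, F (y * z) ∂(gammaMeasure r₂ lam) =
      ∫⁻ z, gammaPDF r₂ lam z * F (y * z) := fun y => by
    have hm : Measurable fun z => F (y * z) := hF.comp (measurable_const_mul y)
    rw [gammaMeasure, lintegral_withDensity_eq_lintegral_mul _ (hg r₂) hm]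
    rfl
  have hmeas : Measurable fun y : ℝ => ∫⁻ z, gammaPDF r₂ lam z * F (y * z) := by
    refine Measurable.lintegral_prod_right'
      (f := fun p : ℝ × ℝ => gammaPDF r₂ lam p.2 * F (p.1 * p.2)) ?_
    exact ((hg r₂).comp measurable_snd).mul (hF.comp (by fun_prop))
  simp_rw [hinner]
  rw [gammaMeasure, lintegral_withDensity_eq_lintegral_mul _ (hg r₁) hmeas,
    lintegral_withDensity_eq_lintegral_mul₀ hdens hF.aemeasurable]
  simp only [Pi.mul_apply]
  -- Only x < 0 is asked for: `gammaPDF` need not vanish at 0, but a single point is null.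
  have hhalf : ∀ G : ℝ → ENNReal, (∀ x, x < 0 → G x = 0) → ∫⁻ x, G x = ∫⁻ x in Ioi 0, G x := by
    intro G hG
    rw [← lintegral_add_compl G measurableSet_Ici (μ := volume) (A := Ici (0 : ℝ)), compl_Ici,
      setLIntegral_congr_fun measurableSet_Iio (g := fun _ => 0) (fun x hx => hG x hx),
      lintegral_zero, add_zero]
    exact setLIntegral_congr Ioi_ae_eq_Ici.symm
  rw [hhalf _ fun x hx => by rw [gammaPDF_of_neg hx, zero_mul]]
  calc _ = ∫⁻ y in Ioi 0, ∫⁻ x in Ioi 0,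
        gammaPDF r₁ lam y * (ENNReal.ofReal y⁻¹ * gammaPDF r₂ lam (x / y)) * F x := by
        refine setLIntegral_congr_fun measurableSet_Ioi fun y hy => ?_
        have hy : 0 < y := hy
        have hm : Measurable fun x => gammaPDF r₂ lam (x / y) * F x :=
          ((hg r₂).comp (measurable_id.div_const y)).mul hF
        have h1 := lintegral_mul_left_real hm hy
        simp_rw [mul_div_cancel_left₀ _ hy.ne'] at h1
        rw [h1, ← mul_assoc, hhalf _ fun x hx => by
          rw [gammaPDF_of_neg (div_neg_of_neg_of_pos hx hy), zero_mul],
          ← lintegral_const_mul _ hm]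
        simp only [mul_assoc]
    _ = ∫⁻ x in Ioi 0, ∫⁻ y in Ioi 0,
        gammaPDF r₁ lam y * (ENNReal.ofReal y⁻¹ * gammaPDF r₂ lam (x / y)) * F x := by
        refine lintegral_lintegral_swap (Measurable.aemeasurable ?_)
        refine Measurable.mul (Measurable.mul ((hg r₁).comp measurable_fst)
          (Measurable.mul ?_ ((hg r₂).comp (measurable_snd.div measurable_fst))))
          (hF.comp measurable_snd)
        exact (measurable_fst.inv).ennreal_ofReal
    _ = _ := by
        refine setLIntegral_congr_fun measurableSet_Ioi fun x hx => ?_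
        rw [lintegral_mul_const, lintegral_gammaPDF_mul hr₁ hr₂ hlam hx]
        exact (hg r₁).mul ((measurable_id.inv.ennreal_ofReal).mul
          ((hg r₂).comp (measurable_const.div measurable_id)))

lemma productGammaDensity_eq {r₁ r₂ lam x : ℝ} (hlam : 0 < lam) (hx : 0 < x) :
    productGammaDensity r₁ r₂ lam x = 2 * (lam ^ r₁ / Real.Gamma r₁ * (lam ^ r₂ / Real.Gamma r₂)) *
      (x ^ ((r₁ + r₂) / 2 - 1) * besselK (r₁ - r₂) (2 * lam * √x)) := by
  have hsx : 0 < √x := Real.sqrt_pos.2 hx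
  have h := besselK_eq (μ := r₁ - r₂) (z := 2 * lam * √x) (by positivity)
  rw [show (2 * lam * √x) ^ 2 / 4 = lam ^ 2 * x by rw [mul_pow, sq_sqrt hx.le]; ring,
    show 2 * lam * √x / 2 = lam * √x by ring, mul_rpow hlam.le hsx.le] at h
  have h2 : x ^ (r₂ - 1) = x ^ ((r₁ + r₂) / 2 - 1) * √x ^ (-(r₁ - r₂)) := by
    rw [sqrt_eq_rpow, ← rpow_mul hx.le, ← rpow_add hx]; ring_nf
  rw [productGammaDensity, h2]
  linear_combination -(lam ^ r₁ / Real.Gamma r₁ * (lam ^ r₂ / Real.Gamma r₂) *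
    x ^ ((r₁ + r₂) / 2 - 1)) * h

lemma isProbabilityMeasure_productGamma {r₁ r₂ lam : ℝ} (hr₁ : 0 < r₁) (hr₂ : 0 < r₂)
    (hlam : 0 < lam) : IsProbabilityMeasure (productGamma r₁ r₂ lam) := by
  have := isProbabilityMeasure_gammaMeasure hr₁ hlam
  have := isProbabilityMeasure_gammaMeasure hr₂ hlam
  exact Measure.isProbabilityMeasure_map (by fun_prop)

/-! ### The Bessel functions as a recessive pair. -/

/-- In v' the recurrence replaces L_(ν-1) by L_(ν+1), which makes its sign visible and reduces the
Wronskian to `bessel_wronskian`. Integrability is a hypothesis because it is later read off from the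
total mass of the product gamma law. -/
lemma recessivePair_bessel {q ν l : ℝ} (hq : 0 < q) (hν : 0 ≤ ν) (hl : 0 < l)
    (hint : IntegrableOn (fun t => t ^ (q + ν + q - 1) * (t ^ (-(q + ν)) * besselL ν (l ^ 2 * t)))
      (Ioi 0)) :
    RecessivePair (q + ν) q ((q + ν) * q) l
      (fun x => x ^ (-q) * besselA ν (l ^ 2 * x))
      (fun x => x ^ (-q - 1) * (-q * besselA ν (l ^ 2 * x) + l ^ 2 * x * besselA (ν + 1) (l ^ 2 * x)))
      (fun x => x ^ (-(q + ν)) * besselL ν (l ^ 2 * x))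
      (fun x => x ^ (-(q + ν) - 1) * (-q * besselL ν (l ^ 2 * x) - besselL (ν + 1) (l ^ 2 * x))) := by
  have hpos : ∀ {x : ℝ}, 0 < x → 0 < l ^ 2 * x := fun hx => by positivity
  have hlin : ∀ x : ℝ, HasDerivAt (fun x => l ^ 2 * x) (l ^ 2) x := fun x =>
    ((hasDerivAt_id' x).const_mul (l ^ 2)).congr_deriv (mul_one _)
  have hA : ∀ {ν : ℝ}, 0 ≤ ν → ∀ x, HasDerivAt (fun x => besselA ν (l ^ 2 * x))
      (besselA (ν + 1) (l ^ 2 * x) * l ^ 2) x := fun hν x =>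
    (hasDerivAt_besselA hν (l ^ 2 * x)).comp x (hlin x)
  have hL : ∀ μ {x : ℝ}, 0 < x → HasDerivAt (fun x => besselL μ (l ^ 2 * x))
      (-besselL (μ - 1) (l ^ 2 * x) * l ^ 2) x := fun μ x hx =>
    (hasDerivAt_besselL μ (hpos hx)).comp x (hlin x)
  have hpow : ∀ r {x : ℝ}, 0 < x → HasDerivAt (fun x => x ^ r) (r * (x ^ r / x)) x := fun r x hx =>
    (hasDerivAt_rpow_const (Or.inl hx.ne')).congr_deriv (by rw [rpow_sub_one hx.ne'])
  have hcancel : ∀ {x : ℝ}, 0 < x → ∀ a : ℝ, x ^ q * (x ^ (-q) * a) = a := fun hx a => by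
    rw [← mul_assoc, ← rpow_add hx]; simp
  refine ⟨by positivity, hq, hl, fun x hx => ?_, fun x hx => ?_, fun x hx => ?_, fun x hx => ?_,
    fun x hx => ?_, fun x hx => ?_, fun x hx => ?_, fun x hx => ?_, fun t x ht htx => ?_, ?_, ?_, ?_,
    hint⟩
  · refine ((hpow (-q) hx).fun_mul (hA hν x)).congr_deriv ?_
    rw [rpow_sub_one hx.ne']
    field_simp
  · refine ((hpow (-q - 1) hx).fun_mul (((hA hν x).const_mul (-q)).fun_add
      ((hlin x).fun_mul (hA (ν := ν + 1) (by linarith) x)))).congr_deriv ?_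
    have r := besselA_recurrence hν (l ^ 2 * x)
    rw [rpow_sub_one hx.ne', show ν + 1 + 1 = ν + 2 by ring]
    field_simp
    rw [mul_comm (l ^ 2) x] at r
    linear_combination l ^ 2 * x * r
  · refine ((hpow (-(q + ν)) hx).fun_mul (hL ν hx)).congr_deriv ?_
    have r := besselL_recurrence ν (hpos hx)
    rw [rpow_sub_one hx.ne']
    field_simp
    rw [mul_comm (l ^ 2) x] at r
    linear_combination -r
  · refine ((hpow (-(q + ν) - 1) hx).fun_mul (((hL ν hx).const_mul (-q)).fun_sub
      (hL (ν + 1) hx))).congr_deriv ?_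
    have r := besselL_recurrence ν (hpos hx)
    rw [rpow_sub_one hx.ne', add_sub_cancel_right]
    field_simp
    rw [mul_comm (l ^ 2) x] at r
    linear_combination q * r
  · have hw := bessel_wronskian hν (hpos hx)
    have hX : x ^ (1 + (q + ν + q)) * (x ^ (-q) * x ^ (-(q + ν) - 1)) = 1 := by
      rw [← rpow_add hx, ← rpow_add hx]; ring_nf; simp
    have hX' : x ^ (-q - 1) * x ^ (-(q + ν)) = x ^ (-q) * x ^ (-(q + ν) - 1) := by
      rw [← rpow_add hx, ← rpow_add hx]; ring_nf
    linear_combination hw + (l ^ 2 * x * besselA (ν + 1) (l ^ 2 * x) * besselL ν (l ^ 2 * x)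
      + besselA ν (l ^ 2 * x) * besselL (ν + 1) (l ^ 2 * x)) * hX
      + x ^ (1 + (q + ν + q)) * (-q * besselA ν (l ^ 2 * x) +
        l ^ 2 * x * besselA (ν + 1) (l ^ 2 * x)) * besselL ν (l ^ 2 * x) * hX'
  · exact mul_pos (rpow_pos_of_pos hx _) (besselA_pos hν (hpos hx).le)
  · exact mul_pos (rpow_pos_of_pos hx _) (besselL_pos ν (hpos hx))
  · refine mul_nonpos_of_nonneg_of_nonpos (rpow_nonneg hx.le _) ?_
    nlinarith [mul_pos hq (besselL_pos ν (hpos hx)), besselL_pos (ν + 1) (hpos hx)]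
  · rw [hcancel ht, hcancel (ht.trans_le htx)]
    exact besselA_mono hν (hpos ht).le (by gcongr)
  · refine ⟨(Real.Gamma (ν + 1))⁻¹, inv_pos.2 (Gamma_pos_of_pos (by linarith)), fun t ht => ?_⟩
    rw [hcancel ht]
    exact inv_Gamma_le_besselA hν (hpos ht).le
  -- A single term of the power series of degree k > q already outgrows x^(-q).
  · obtain ⟨k, hk⟩ := exists_nat_gt q
    have hc := besselCoeff_pos hν k
    refine tendsto_atTop_mono' _ ?_ ((tendsto_rpow_atTop (sub_pos.2 hk)).const_mul_atTop
      (show 0 < besselCoeff ν k * (l ^ 2) ^ k by positivity))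
    filter_upwards [eventually_gt_atTop 0] with x hx
    calc besselCoeff ν k * (l ^ 2) ^ k * x ^ ((k : ℝ) - q)
        = x ^ (-q) * (besselCoeff ν k * (l ^ 2 * x) ^ k) := by
          rw [sub_eq_add_neg, rpow_add hx, rpow_natCast, mul_pow]; ring
      _ ≤ _ := mul_le_mul_of_nonneg_left (besselCoeff_mul_pow_le hν (hpos hx).le k)
          (rpow_nonneg hx.le _)
  -- On (0, 1] the decreasing function L_ν is at least its value at l², so the power alone forces
  -- divergence, including for ν = 0.
  · have h1 : Tendsto (fun x : ℝ => x ^ (-(q + ν))) (𝓝[>] 0) atTop :=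
      tendsto_rpow_neg_nhdsGT_zero (by linarith)
    refine tendsto_atTop_mono' _ ?_ (h1.atTop_mul_const (besselL_pos ν (hpos one_pos)))
    filter_upwards [Ioc_mem_nhdsGT (one_pos : (0 : ℝ) < 1)] with x hx
    exact mul_le_mul_of_nonneg_left (besselL_anti ν (hpos hx.1) (by gcongr; exact hx.2))
      (rpow_nonneg hx.1.le _)

lemma besselI_two_mul_sqrt {r₁ r₂ lam t : ℝ} (hlam : 0 < lam) (ht : 0 < t) :
    besselI |r₁ - r₂| (2 * lam * √t) = lam ^ |r₁ - r₂| *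
      (t ^ ((r₁ + r₂) / 2) * (t ^ (-min r₁ r₂) * besselA |r₁ - r₂| (lam ^ 2 * t))) := by
  have hst : 0 < √t := Real.sqrt_pos.2 ht
  have he : t ^ ((r₁ + r₂) / 2) * t ^ (-min r₁ r₂) = √t ^ |r₁ - r₂| := by
    rw [sqrt_eq_rpow, ← rpow_mul ht.le, ← rpow_add ht]
    congr 1
    linarith [max_sub_min_eq_abs r₁ r₂, min_add_max r₁ r₂, abs_sub_comm r₁ r₂]
  rw [besselI_eq (by positivity), ← mul_assoc (t ^ _), he,
    show (2 * lam * √t) ^ 2 / 4 = lam ^ 2 * t by rw [mul_pow, sq_sqrt ht.le]; ring,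
    show 2 * lam * √t / 2 = lam * √t by ring, mul_rpow hlam.le hst.le, mul_assoc]

lemma besselK_two_mul_sqrt {r₁ r₂ lam t : ℝ} (hlam : 0 < lam) (ht : 0 < t) :
    2 * besselK (r₁ - r₂) (2 * lam * √t) = lam ^ (-|r₁ - r₂|) *
      (t ^ ((r₁ + r₂) / 2) * (t ^ (-(min r₁ r₂ + |r₁ - r₂|)) * besselL |r₁ - r₂| (lam ^ 2 * t))) := by
  have hst : 0 < √t := Real.sqrt_pos.2 ht
  have he : t ^ ((r₁ + r₂) / 2) * t ^ (-(min r₁ r₂ + |r₁ - r₂|)) = √t ^ (-|r₁ - r₂|) := by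
    rw [sqrt_eq_rpow, ← rpow_mul ht.le, ← rpow_add ht]
    congr 1
    linarith [max_sub_min_eq_abs r₁ r₂, min_add_max r₁ r₂, abs_sub_comm r₁ r₂]
  -- K is even in its order, because cosh is even.
  have habs : besselK (r₁ - r₂) (2 * lam * √t) = besselK |r₁ - r₂| (2 * lam * √t) := by
    unfold besselK
    refine setIntegral_congr_fun measurableSet_Ioi fun z hz => ?_
    have : Real.cosh (|r₁ - r₂| * z) = Real.cosh ((r₁ - r₂) * z) := by
      rw [← Real.cosh_abs ((r₁ - r₂) * z), abs_mul, abs_of_pos (mem_Ioi.1 hz)]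
    simp only [this]
  rw [habs, besselK_eq (by positivity), ← mul_assoc (t ^ _), he,
    show (2 * lam * √t) ^ 2 / 4 = lam ^ 2 * t by rw [mul_pow, sq_sqrt ht.le]; ring,
    show 2 * lam * √t / 2 = lam * √t by ring, mul_rpow hlam.le hst.le, mul_assoc]

/-! ### Transfer to the Stein equation. -/

lemma AbsolutelyContinuousOnInterval.congr_on {f g : ℝ → ℝ} {a b : ℝ}
    (hf : AbsolutelyContinuousOnInterval f a b) (h : EqOn f g (uIcc a b)) :
    AbsolutelyContinuousOnInterval g a b := by
  rw [absolutelyContinuousOnInterval_iff] at hf ⊢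
  intro ε hε
  obtain ⟨δ, hδ, H⟩ := hf ε hε
  refine ⟨δ, hδ, fun E hE hEδ => ?_⟩
  refine lt_of_eq_of_lt (Finset.sum_congr rfl fun i hi => ?_) (H E hE hEδ)
  rw [h (hE.1 i hi).1, h (hE.1 i hi).2]

lemma SteinEquationAt.of_hasDerivAt {r₁ r₂ lam x : ℝ} {h f : ℝ → ℝ} (hx : 0 < x)
    (hf : DifferentiableAt ℝ f x)
    (hf' : HasDerivAt (deriv f) ((centred r₁ r₂ lam h x + (lam ^ 2 * x - r₁ * r₂) * f x
      - (1 + (r₁ + r₂)) * x * deriv f x) / x ^ 2) x) :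
    SteinEquationAt r₁ r₂ lam h f x := by
  refine ⟨hf, hf'.differentiableAt, ?_⟩
  rw [hf'.deriv]
  field_simp
  ring

lemma SteinEquationAt.hasDerivAt {r₁ r₂ lam x : ℝ} {h f : ℝ → ℝ} (hx : 0 < x)
    (hf : SteinEquationAt r₁ r₂ lam h f x) :
    HasDerivAt (deriv f) ((centred r₁ r₂ lam h x + (lam ^ 2 * x - r₁ * r₂) * f x
      - (1 + (r₁ + r₂)) * x * deriv f x) / x ^ 2) x := by
  refine hf.2.1.hasDerivAt.congr_deriv ?_
  rw [← hf.2.2]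
  field_simp
  ring

/-- The second derivative need not be continuous, but the equation bounds it on compact subintervals
of (0, ∞), so g' is Lipschitz there. -/
lemma IsSteinSolution.of_everywhere {r₁ r₂ lam C : ℝ} {h g : ℝ → ℝ}
    (hC : ∀ t, 0 < t → |centred r₁ r₂ lam h t| ≤ C)
    (hg : ∀ x, 0 < x → SteinEquationAt r₁ r₂ lam h g x) : IsSteinSolution r₁ r₂ lam h g := by
  refine ⟨fun x hx => (hg x hx).1, fun a b ha hab => ?_,
    (ae_restrict_iff' measurableSet_Ioi).2 (Eventually.of_forall hg)⟩
  have hsub := uIcc_subset_Ioi ha (ha.trans_le hab)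
  have c0 : ContinuousOn g (Ioi 0) := fun x hx => (hg x hx).1.continuousAt.continuousWithinAt
  have c1 : ContinuousOn (deriv g) (Ioi 0) := fun x hx =>
    (hg x hx).2.1.continuousAt.continuousWithinAt
  have c2 : ContinuousOn (fun x => ((lam ^ 2 * x - r₁ * r₂) * g x
      - (1 + (r₁ + r₂)) * x * deriv g x) / x ^ 2) (Ioi 0) := RecessivePair.continuousOn_ode _ c0 c1
  obtain ⟨B, hB⟩ := isCompact_uIcc.exists_bound_of_continuousOn (c2.mono hsub)
  refine absolutelyContinuousOnInterval_of_deriv_bound (C := C / a ^ 2 + B)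
    (fun x hx => (hg x (hsub hx)).hasDerivAt (hsub hx)) fun x hx => ?_
  have hx0 : 0 < x := hsub hx
  rw [add_sub_assoc, add_div]
  refine (abs_add_le _ _).trans (add_le_add ?_ (hB x hx))
  rw [abs_div, abs_of_pos (by positivity : 0 < x ^ 2)]
  have hax : a ≤ x := by rw [uIcc_of_le hab] at hx; exact hx.1
  have := hC x hx0
  have : 0 ≤ C := (abs_nonneg _).trans this
  gcongr

theorem lemma2p6 (r₁ r₂ lam : ℝ) (hr₁ : 0 < r₁) (hr₂ : 0 < r₂) (hlam : 0 < lam)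
    (h : ℝ → ℝ) (h_meas : AEMeasurable h (volume.restrict (Ioi (0 : ℝ))))
    (h_bdd : BoundedOnPos h) :
    -- the expectation and the integrals in the two formulas converge absolutely
    Integrable h (productGamma r₁ r₂ lam) ∧
    (∀ x, 0 < x → IntegrableOn (integrandI r₁ r₂ lam h) (Ioo 0 x)) ∧
    IntegrableOn (integrandK r₁ r₂ lam h) (Ioi 0) ∧
    -- the two formulas agree
    (∀ x, 0 < x → steinSolution r₁ r₂ lam h x = steinSolution' r₁ r₂ lam h x) ∧
    -- they give a bounded solution
    IsSteinSolution r₁ r₂ lam h (steinSolution r₁ r₂ lam h) ∧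
    BoundedOnPos (steinSolution r₁ r₂ lam h) ∧
    -- which satisfies the equation at each point of continuity of `h`
    (∀ x, 0 < x → ContinuousAt h x →
      SteinEquationAt r₁ r₂ lam h (steinSolution r₁ r₂ lam h) x) ∧
    -- and is the only bounded solution, among almost everywhere solutions
    (∀ g : ℝ → ℝ, IsSteinSolution r₁ r₂ lam h g → BoundedOnPos g →
      EqOn g (steinSolution r₁ r₂ lam h) (Ioi 0)) ∧
    -- and in particular among functions that satisfy the equation everywhere
    (∀ g : ℝ → ℝ, (∀ x, 0 < x → SteinEquationAt r₁ r₂ lam h g x) → BoundedOnPos g →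
      EqOn g (steinSolution r₁ r₂ lam h) (Ioi 0)) := by
  have hPG := isProbabilityMeasure_productGamma hr₁ hr₂ hlam
  have hPGeq := productGamma_eq hr₁ hr₂ hlam
  obtain ⟨C₀, hC₀⟩ := h_bdd
  set ν := |r₁ - r₂| with hν
  set q := min r₁ r₂ with hq
  have hqpos : 0 < q := lt_min hr₁ hr₂
  have hν0 : 0 ≤ ν := abs_nonneg _
  have hqν : q + ν = max r₁ r₂ := by
    linarith [max_sub_min_eq_abs r₁ r₂, abs_sub_comm r₁ r₂]
  have hsum : q + ν + q = r₁ + r₂ := by rw [hqν, add_comm]; exact min_add_max r₁ r₂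
  have hprod : (q + ν) * q = r₁ * r₂ := by rw [hqν, mul_comm]; exact min_mul_max r₁ r₂
  set u : ℝ → ℝ := fun x => x ^ (-q) * besselA ν (lam ^ 2 * x) with hu
  set v : ℝ → ℝ := fun x => x ^ (-(q + ν)) * besselL ν (lam ^ 2 * x) with hv
  set k : ℝ → ℝ := centred r₁ r₂ lam h with hkdef
  have hLpos : 0 < lam ^ ν := rpow_pos_of_pos hlam _
  have hLneg : lam ^ (-ν) = (lam ^ ν)⁻¹ := rpow_neg hlam.le _
  have hI : ∀ t, 0 < t → besselI ν (2 * lam * √t) = lam ^ ν * (t ^ ((r₁ + r₂) / 2) * u t) :=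
    fun t ht => besselI_two_mul_sqrt hlam ht
  have hK : ∀ t, 0 < t →
      2 * besselK (r₁ - r₂) (2 * lam * √t) = (lam ^ ν)⁻¹ * (t ^ ((r₁ + r₂) / 2) * v t) :=
    fun t ht => by rw [← hLneg]; exact besselK_two_mul_sqrt hlam ht
  have hpow : ∀ t : ℝ, 0 < t →
      t ^ ((r₁ + r₂) / 2 - 1) * t ^ ((r₁ + r₂) / 2) = t ^ (q + ν + q - 1) := fun t ht => by
    rw [← rpow_add ht, hsum]; ring_nf
  -- the density of the product gamma distribution
  set Z := lam ^ r₁ / Real.Gamma r₁ * (lam ^ r₂ / Real.Gamma r₂) * (lam ^ ν)⁻¹ with hZ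
  have hZpos : 0 < Z := by
    have := Gamma_pos_of_pos hr₁
    have := Gamma_pos_of_pos hr₂
    positivity
  have hdens : ∀ t, 0 < t → productGammaDensity r₁ r₂ lam t = Z * (t ^ (q + ν + q - 1) * v t) := by
    intro t ht
    rw [productGammaDensity_eq hlam ht, ← hpow t ht, hZ]
    linear_combination lam ^ r₁ / Real.Gamma r₁ * (lam ^ r₂ / Real.Gamma r₂) *
      t ^ ((r₁ + r₂) / 2 - 1) * hK t ht
  have hvcont : ContinuousOn v (Ioi 0) := (continuousOn_weight _).mul
    ((continuousOn_besselL ν).comp (by fun_prop) fun x hx => mul_pos (by positivity) (mem_Ioi.1 hx))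
  have hdcont : ContinuousOn (productGammaDensity r₁ r₂ lam) (Ioi 0) :=
    (continuousOn_const.mul ((continuousOn_weight _).mul hvcont)).congr fun t ht => hdens t ht
  have hdmeas : AEMeasurable (fun x => ENNReal.ofReal (productGammaDensity r₁ r₂ lam x))
      (volume.restrict (Ioi 0)) := (hdcont.aemeasurable measurableSet_Ioi).ennreal_ofReal
  -- The density has total mass 1, which replaces any estimate of K at 0 and at infinity.
  have hdint : IntegrableOn (productGammaDensity r₁ r₂ lam) (Ioi 0) := by
    refine ⟨hdcont.aestronglyMeasurable measurableSet_Ioi, ?_⟩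
    rw [hasFiniteIntegral_iff_ofReal ((ae_restrict_iff' measurableSet_Ioi).2
      (Eventually.of_forall fun x hx => (productGammaDensity_pos hr₁ hr₂ hlam hx).le))]
    have h1 : productGamma r₁ r₂ lam univ = 1 := measure_univ
    rw [hPGeq, withDensity_apply _ MeasurableSet.univ, setLIntegral_univ] at h1
    rw [h1]
    exact ENNReal.one_lt_top
  have hvint : IntegrableOn (fun t => t ^ (q + ν + q - 1) * v t) (Ioi 0) := by
    refine IntegrableOn.congr_fun (hdint.const_mul Z⁻¹) (fun t ht => ?_) measurableSet_Ioi
    simp only [hdens t ht, inv_mul_cancel_left₀ hZpos.ne']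
  have P := recessivePair_bessel hqpos hν0 hlam hvint
  rw [← hu, ← hv, hprod] at P
  -- the right-hand side
  have hkmeas : AEStronglyMeasurable k (volume.restrict (Ioi 0)) :=
    (h_meas.sub aemeasurable_const).aestronglyMeasurable
  obtain ⟨C, hC⟩ : ∃ C, ∀ t, 0 < t → |k t| ≤ C :=
    ⟨C₀ + |∫ y, h y ∂(productGamma r₁ r₂ lam)|, fun t ht =>
      (abs_sub _ _).trans (add_le_add (hC₀ t ht) le_rfl)⟩
  have hac : productGamma r₁ r₂ lam ≪ volume.restrict (Ioi 0) := by
    rw [hPGeq]; exact withDensity_absolutelyContinuous _ _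
  have hhint : Integrable h (productGamma r₁ r₂ lam) := by
    refine Integrable.of_bound (h_meas.mono_ac hac).aestronglyMeasurable C₀ (hac.ae_le ?_)
    exact (ae_restrict_iff' measurableSet_Ioi).2 (Eventually.of_forall hC₀)
  -- This is E h̃(Y) = 0 written with the density Z t^(q+ν+q-1) v(t) and divided by Z.
  have hzero : ∫ t in Ioi (0 : ℝ), t ^ (q + ν + q - 1) * v t * k t = 0 := by
    have h1 : ∫ y, k y ∂(productGamma r₁ r₂ lam) = 0 := by
      rw [hkdef]
      unfold centred
      rw [integral_sub hhint (integrable_const _), integral_const]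
      simp
    rw [hPGeq, integral_withDensity_eq_integral_toReal_smul₀ hdmeas
      (Eventually.of_forall fun _ => ENNReal.ofReal_lt_top)] at h1
    have h2 : ∫ t in Ioi (0 : ℝ), (ENNReal.ofReal (productGammaDensity r₁ r₂ lam t)).toReal • k t =
        ∫ t in Ioi (0 : ℝ), Z * (t ^ (q + ν + q - 1) * v t * k t) := by
      refine setIntegral_congr_fun measurableSet_Ioi fun t ht => ?_
      simp only [smul_eq_mul]
      rw [ENNReal.toReal_ofReal (productGammaDensity_pos hr₁ hr₂ hlam ht).le, hdens t ht]
      ring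
    rw [h2, integral_const_mul] at h1
    exact (mul_eq_zero.1 h1).resolve_left hZpos.ne'
  -- the integrands
  have hiI : ∀ t ∈ Ioi (0 : ℝ),
      integrandI r₁ r₂ lam h t = lam ^ ν * (t ^ (q + ν + q - 1) * u t * k t) := by
    intro t ht
    rw [integrandI, ← hν, hI t ht, ← hpow t ht]; ring
  have hiK : ∀ t ∈ Ioi (0 : ℝ),
      integrandK r₁ r₂ lam h t = (lam ^ ν)⁻¹ / 2 * (t ^ (q + ν + q - 1) * v t * k t) := by
    intro t ht
    rw [integrandK, ← hpow t ht]
    linear_combination t ^ ((r₁ + r₂) / 2 - 1) * k t / 2 * hK t ht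
  have hUint := fun x (hx : 0 < x) => P.integrableOn_u hkmeas hC hx
  have hNint := fun x (hx : 0 < x) => P.intervalIntegrable_v hkmeas hC hx
  have hVint := P.integrableOn_v hkmeas hC
  have hIU : ∀ x, 0 < x → ∫ t in Ioo 0 x, integrandI r₁ r₂ lam h t =
      lam ^ ν * weightedPrimitive (q + ν + q - 1) u k x := fun x hx => by
    rw [setIntegral_congr_fun measurableSet_Ioo fun t ht => hiI t ht.1, integral_const_mul,
      weightedPrimitive, intervalIntegral.integral_of_le hx.le, integral_Ioc_eq_integral_Ioo]
  have hIN : ∀ x, 0 < x → ∫ t in Ioo 0 x, integrandK r₁ r₂ lam h t =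
      (lam ^ ν)⁻¹ / 2 * weightedPrimitive (q + ν + q - 1) v k x := fun x hx => by
    rw [setIntegral_congr_fun measurableSet_Ioo fun t ht => hiK t ht.1, integral_const_mul,
      weightedPrimitive, intervalIntegral.integral_of_le hx.le, integral_Ioc_eq_integral_Ioo]
  have hIT : ∀ x, 0 < x → ∫ t in Ioi x, integrandK r₁ r₂ lam h t =
      -((lam ^ ν)⁻¹ / 2 * weightedPrimitive (q + ν + q - 1) v k x) := fun x hx => by
    rw [setIntegral_congr_fun measurableSet_Ioi fun t ht => hiK t (hx.trans ht), integral_const_mul,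
      P.primitive_v_eq hkmeas hC hzero hx]
    ring
  set f := steinSolution r₁ r₂ lam h with hf
  set F := paramSolution (q + ν + q - 1) u v k with hFdef
  have hfF : ∀ x ∈ Ioi (0 : ℝ), f x = F x := by
    intro x hx
    have hx0 : 0 < x := hx
    have hxp : 0 < x ^ ((r₁ + r₂) / 2) := rpow_pos_of_pos hx0 _
    rw [hf, steinSolution, hIU x hx, hIN x hx, hK x hx, ← hν, hI x hx, hFdef, paramSolution]
    field_simp
  have hev : ∀ x, 0 < x → f =ᶠ[𝓝 x] F := fun x hx =>
    mem_of_superset (Ioi_mem_nhds hx) hfF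
  have hdiff : ∀ x, 0 < x → DifferentiableAt ℝ f x := fun x hx =>
    ((P.hasDerivAt_paramSolution hkmeas hC hx).congr_of_eventuallyEq (hev x hx)).differentiableAt
  have hAC : ∀ a b : ℝ, 0 < a → a ≤ b → AbsolutelyContinuousOnInterval (deriv f) a b := by
    intro a b ha hab
    refine (P.ac_deriv_paramSolution hkmeas hC ha hab).congr_on fun x hx => ?_
    have hx0 : 0 < x := uIcc_subset_Ioi ha (ha.trans_le hab) hx
    exact ((P.hasDerivAt_paramSolution hkmeas hC hx0).congr_of_eventuallyEq (hev x hx0)).deriv.symm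
  have heq : ∀ x, 0 < x →
      HasDerivAt (weightedPrimitive (q + ν + q - 1) u k) (x ^ (q + ν + q - 1) * u x * k x) x →
      HasDerivAt (weightedPrimitive (q + ν + q - 1) v k) (x ^ (q + ν + q - 1) * v x * k x) x →
      SteinEquationAt r₁ r₂ lam h f x := by
    intro x hx h1 h2
    refine SteinEquationAt.of_hasDerivAt hx (hdiff x hx) ?_
    have h3 := (P.hasDerivAt_deriv_paramSolution hkmeas hC hx h1 h2).congr_of_eventuallyEq
      (hev x hx).deriv
    rwa [← hFdef, ← (hev x hx).deriv_eq, ← hfF x hx, hsum] at h3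
  have hsol : IsSteinSolution r₁ r₂ lam h f := by
    refine ⟨hdiff, hAC, (ae_restrict_iff' measurableSet_Ioi).2 ?_⟩
    filter_upwards [ae_hasDerivAt_primitive hUint, ae_hasDerivAt_primitive hNint] with x h1 h2 hx
    exact heq x hx (h1 hx) (h2 hx)
  have hbdd : BoundedOnPos f := by
    obtain ⟨B, hB⟩ := P.bounded_paramSolution hkmeas hC hzero
    exact ⟨B, fun x hx => by rw [hfF x hx]; exact hB x hx⟩
  have huniq : ∀ g : ℝ → ℝ, IsSteinSolution r₁ r₂ lam h g → BoundedOnPos g → EqOn g f (Ioi 0) := by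
    intro g hg ⟨B, hB⟩ x hx
    obtain ⟨B', hB'⟩ := hbdd
    refine sub_eq_zero.1 (P.eq_zero_of_bounded (w := fun x => g x - f x)
      (w₁ := fun x => deriv g x - deriv f x)
      (fun x hx => (hg.1 x hx).hasDerivAt.fun_sub (hdiff x hx).hasDerivAt)
      (fun a b ha hab => (hg.2.1 a b ha hab).fun_sub (hAC a b ha hab)) ?_
      ⟨B + B', fun x hx => (abs_sub _ _).trans (add_le_add (hB x hx) (hB' x hx))⟩ hx)
    filter_upwards [(ae_restrict_iff' measurableSet_Ioi).1 hg.2.2,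
      (ae_restrict_iff' measurableSet_Ioi).1 hsol.2.2] with x h1 h2 hx
    refine (((h1 hx).hasDerivAt hx).fun_sub ((h2 hx).hasDerivAt hx)).congr_deriv ?_
    rw [hsum]
    ring
  refine ⟨hhint, fun x hx => ?_, ?_, fun x hx => ?_, hsol, hbdd, fun x hx hcont => ?_, huniq,
    fun g hg hgb => huniq g (IsSteinSolution.of_everywhere hC hg) hgb⟩
  · have h1 := (intervalIntegrable_iff_integrableOn_Ioo_of_le hx.le).1 (hUint x hx)
    exact IntegrableOn.congr_fun (h1.const_mul (lam ^ ν)) (fun t ht => (hiI t ht.1).symm) measurableSet_Ioo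
  · exact IntegrableOn.congr_fun (hVint.const_mul ((lam ^ ν)⁻¹ / 2)) (fun t ht => (hiK t ht).symm)
      measurableSet_Ioi
  · rw [hf, steinSolution, steinSolution', hIN x hx, hIT x hx]
    ring
  · have hkc : ContinuousAt k x := hcont.sub continuousAt_const
    -- Where h is continuous, the fundamental theorem of calculus differentiates both primitives at
    -- that very point.
    have hprim : ∀ y : ℝ → ℝ, ContinuousOn y (Ioi 0) →
        IntervalIntegrable (fun t => t ^ (q + ν + q - 1) * y t * k t) volume 0 x →
        HasDerivAt (weightedPrimitive (q + ν + q - 1) y k) (x ^ (q + ν + q - 1) * y x * k x) x := by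
      intro y hy hi
      refine intervalIntegral.integral_hasDerivAt_right hi
        ⟨Ioi 0, Ioi_mem_nhds hx, RecessivePair.aesm_weight _ hy hkmeas⟩ ?_
      exact (((continuousOn_weight _).mul hy).continuousAt (Ioi_mem_nhds hx)).mul hkc
    exact heq x hx (hprim u P.continuousOn_u (hUint x hx)) (hprim v P.continuousOn_v (hNint x hx))

end
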